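/- A vertex operator algebra (VOA) is a complex vector space $V=\bigoplus_{n\in\mathbb Z}V_n$ with all $V_n$ finite-dimensional and $V_n=0$ for $n\ll 0$, together with a linear map $u\mapsto Y(u,z)=\sum_{n\in\mathbb Z}u(n)z^{-n-1}\in \mathrm{End}(V)[[z,z^{-1}]]$ (where, for all $u,v$, $u(n)v=0$ for $n\gg 0$), a vacuum vector $\mathbf 1$ and a conformal vector $\omega$ satisfying the usual axioms: $Y(\mathbf 1,z)=\mathrm{Id}_V$, $Y(u,z)\mathbf 1\in u+zV[[z]]$, the Jacobi identity, the Virasoro relations for the operators $L(n)=\omega(n+1)$ with some central charge $c\in\mathbb C$, $L(0)|_{V_n}=n$, and $Y(L(-1)u,z)=\frac{d}{dz}Y(u,z)$. It is simple if $V\neq 0$ and $V$ has no ideals other than $0$ and $V$. An automorphism of $V$ is an invertible linear map that fixes $\mathbf 1$ and $\omega$ and preserves all products $u(n)v$; these form the group $\mathrm{Aut}(V)$. The space $V_1$ is a finite-dimensional left Leibniz algebra with bracket $[uv]=u(0)v$, i.e. $[a[bc]]=[[ab]c]+[b[ac]]$. A Levi subalgebra of a finite-dimensional left Leibniz algebra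 $A$ is a subalgebra $S\subseteq A$ that is a semisimple Lie algebra and satisfies $A=S\oplus B$ as vector spaces, where $B$ is the solvable radical of $A$ (its largest solvable two-sided ideal). **Theorem.** Let $V$ be a simple VOA (with no restriction on the conformal grading beyond the above). Let $N=\langle a(0)a \mid a\in V_1\rangle$ (linear span) be the Leibniz kernel of $V_1$, and let $F=\{a\in V_1\mid a(0)N=0\}$ be its annihilator, which is a Leibniz subalgebra of $V_1$. Then: (a) $\mathrm{Aut}(V)$ acts transitively on the Levi subalgebras of $F$: if $g\in\mathrm{Aut}(V)$ and $S$ is a Levi subalgebra of $F$ then so is $g(S)$, and for any two Levi subalgebras $S_1,S_2$ of $F$ there is $g\in\mathrm{Aut}(V)$ with $g(S_1)=S_2$. (b) Let $S$ be a Levi subalgebra of $F$. Then $u(1)v\in\mathbb C\mathbf 1$ for all $u,v\in S$, and the vertex operators $Y(u,z)$ $(u\in S)$ close on an affine algebra, i.e. there is a bilinear form $\alpha:S\times S\to\mathbb C$ with $u(1)v=\alpha(u,v)\mathbf 1$ and $$[u(m),v(n)]=(u(0)v)(m+n)+m\,\alpha(u,v)\,\delta_{m+n,0}\,\mathrm{Id}_V\qquad(u,v\in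 S,\ m,n\in\mathbb Z).$$ -/

import Mathlib

noncomputable section

namespace LeibnizAlg

variable {L : Type*} [AddCommGroup L] [Module ℂ L]

/-- A bilinear bracket `β` makes `L` a left Leibniz algebra: `[a[bc]] = [[ab]c] + [b[ac]]`. -/
def IsLeftLeibniz (β : L →ₗ[ℂ] L →ₗ[ℂ] L) : Prop :=
  ∀ a b c : L, β a (β b c) = β (β a b) c + β b (β a c)

/-- The subspace `A` is closed under the bracket. -/
def IsSubalgebra (β : L →ₗ[ℂ] L →ₗ[ℂ] L) (A : Submodule ℂ L) : Prop :=
  ∀ a ∈ A, ∀ b ∈ A, β a b ∈ A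

/-- `I` is a two-sided ideal of the subalgebra `A`. -/
def IsIdealOf (β : L →ₗ[ℂ] L →ₗ[ℂ] L) (A I : Submodule ℂ L) : Prop :=
  I ≤ A ∧ ∀ a ∈ A, ∀ x ∈ I, β a x ∈ I ∧ β x a ∈ I

/-- The derived series: `A⁽⁰⁾ = A`, and `A⁽ᵏ⁺¹⁾` is the span of all `[xy]` with `x, y ∈ A⁽ᵏ⁾`. -/
def derivedSeries (β : L →ₗ[ℂ] L →ₗ[ℂ] L) (A : Submodule ℂ L) : ℕ → Submodule ℂ L
  | 0 => A
  | k + 1 => Submodule.map₂ β (derivedSeries β A k) (derivedSeries β A k)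

/-- `A` is solvable: some term of the derived series vanishes. -/
def IsSolvable (β : L →ₗ[ℂ] L →ₗ[ℂ] L) (A : Submodule ℂ L) : Prop :=
  ∃ k : ℕ, derivedSeries β A k = ⊥

/-- The solvable radical of `A`: the sum of all solvable two-sided ideals of `A`
(for finite-dimensional `A` this is the largest solvable ideal). -/
def solvableRadical (β : L →ₗ[ℂ] L →ₗ[ℂ] L) (A : Submodule ℂ L) : Submodule ℂ L :=
  sSup {I : Submodule ℂ L | IsIdealOf β A I ∧ IsSolvable β I}

/-- A subalgebra of a left Leibniz algebra on which the bracket is alternating is a Lie ring. -/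
abbrev lieRing {β : L →ₗ[ℂ] L →ₗ[ℂ] L} (hβ : IsLeftLeibniz β) {S : Submodule ℂ L}
    (hS : IsSubalgebra β S) (halt : ∀ a ∈ S, β a a = 0) : LieRing S :=
  { (inferInstance : AddCommGroup S) with
    bracket := fun a b => ⟨β a b, hS a a.2 b b.2⟩
    add_lie := fun a b c => Subtype.ext (by simp)
    lie_add := fun a b c => Subtype.ext (by simp)
    lie_self := fun a => Subtype.ext (halt a a.2)
    leibniz_lie := fun a b c => Subtype.ext (hβ a b c) }

/-- A subalgebra of a left Leibniz algebra on which the bracket is alternating is a complex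
Lie algebra. -/
abbrev lieAlgebra {β : L →ₗ[ℂ] L →ₗ[ℂ] L} (hβ : IsLeftLeibniz β) {S : Submodule ℂ L}
    (hS : IsSubalgebra β S) (halt : ∀ a ∈ S, β a a = 0) :
    @LieAlgebra ℂ S _ (lieRing hβ hS halt) :=
  letI := lieRing hβ hS halt
  { (inferInstance : Module ℂ S) with
    lie_smul := fun t a b => Subtype.ext ((β (a : L)).map_smul t (b : L)) }

/-- `S` is a Levi subalgebra of `A`: it is a semisimple Lie subalgebra, and `A = S ⊕ B` as a
vector space, where `B` is the solvable radical of `A`. -/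
structure IsLeviSubalgebra {β : L →ₗ[ℂ] L →ₗ[ℂ] L} (hβ : IsLeftLeibniz β)
    (A S : Submodule ℂ L) : Prop where
  isSubalgebra : IsSubalgebra β S
  alternating : ∀ a ∈ S, β a a = 0
  isSemisimple : @LieAlgebra.IsSemisimple ℂ S _ (lieRing hβ isSubalgebra alternating)
    (lieAlgebra hβ isSubalgebra alternating)
  inf_eq : S ⊓ solvableRadical β A = ⊥
  sup_eq : S ⊔ solvableRadical β A = A

end LeibnizAlg

/-- For a state-field map `Y`, the mode `u(n)` in `Y(u,z) = ∑ u(n) z^(-n-1)`, linear in `u`. -/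
def vertexMode {V : Type*} [AddCommGroup V] [Module ℂ V] (Y : V →ₗ[ℂ] VertexOperator ℂ V)
    (n : ℤ) : V →ₗ[ℂ] Module.End ℂ V :=
  LinearMap.proj n ∘ₗ VertexOperator.ncoeff ∘ₗ Y

/-- A vertex operator algebra structure `(V, Y, 𝟏, ω)` on a complex vector space `V`. That
`u(n)v = 0` for `n` large is part of the type of `Y`. -/
structure VertexOperatorAlgebra (V : Type*) [AddCommGroup V] [Module ℂ V] where
  /-- the state-field correspondence `u ↦ Y(u,z)` -/
  Y : V →ₗ[ℂ] VertexOperator ℂ V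
  /-- the vacuum vector `𝟏` -/
  vacuum : V
  /-- the conformal vector `ω`; its modes are `L(n) = ω(n+1)` -/
  conformal : V
  /-- the central charge -/
  centralCharge : ℂ
  /-- the homogeneous spaces `V_n` -/
  weightSpace : ℤ → Submodule ℂ V
  isInternal : DirectSum.IsInternal weightSpace
  finiteDimensional : ∀ n, FiniteDimensional ℂ (weightSpace n)
  bounded_below : ∃ n₀ : ℤ, ∀ n < n₀, weightSpace n = ⊥
  /-- `Y(𝟏,z) = id` -/
  vacuum_mode : ∀ n : ℤ, vertexMode Y n vacuum = if n = -1 then LinearMap.id else 0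
  /-- `Y(u,z)𝟏` is a power series in `z` with constant term `u` -/
  mode_vacuum : ∀ (u : V) (n : ℤ), -1 ≤ n →
    vertexMode Y n u vacuum = if n = -1 then u else 0
  /-- the Jacobi identity, in components; all three sums have finite support -/
  jacobi : ∀ (u v w : V) (p q r : ℤ),
    ∑ᶠ i : ℕ, ((Ring.choose p i : ℤ) : ℂ) •
        vertexMode Y (p + q - i) (vertexMode Y (r + i) u v) w =
      ∑ᶠ i : ℕ, ((-1 : ℂ) ^ i * ((Ring.choose r i : ℤ) : ℂ)) •
        vertexMode Y (p + r - i) u (vertexMode Y (q + i) v w) -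
      ∑ᶠ i : ℕ, ((-1 : ℂ) ^ r * (-1 : ℂ) ^ i * ((Ring.choose r i : ℤ) : ℂ)) •
        vertexMode Y (q + r - i) v (vertexMode Y (p + i) u w)
  /-- the Virasoro relations for `L(n) = ω(n+1)` -/
  virasoro : ∀ m n : ℤ,
    ⁅vertexMode Y (m + 1) conformal, vertexMode Y (n + 1) conformal⁆ =
      ((m : ℂ) - n) • vertexMode Y (m + n + 1) conformal +
        (if m + n = 0 then ((m : ℂ) ^ 3 - m) / 12 * centralCharge else 0) • LinearMap.id
  /-- `V_n` is the space of states of conformal weight `n` -/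
  weight_eq : ∀ (n : ℤ), ∀ v ∈ weightSpace n, vertexMode Y 1 conformal v = (n : ℂ) • v
  /-- `Y(L(-1)u,z)` is the derivative of `Y(u,z)` -/
  translation : ∀ (u : V) (n : ℤ),
    vertexMode Y n (vertexMode Y 0 conformal u) = (-(n : ℂ)) • vertexMode Y (n - 1) u

namespace VertexOperatorAlgebra

variable {V : Type*} [AddCommGroup V] [Module ℂ V] (𝒱 : VertexOperatorAlgebra V)

/-- The mode `u(n)`. -/
abbrev mode (u : V) (n : ℤ) : Module.End ℂ V := vertexMode 𝒱.Y n u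

/-- `V` is simple: it is irreducible as a module over itself, i.e. it is nonzero and its only
subspaces stable under all modes `u(n)` are `0` and `V`. (By skew-symmetry of `Y` such subspaces
are the same as two-sided ideals.) -/
def IsSimple : Prop :=
  Nontrivial V ∧ ∀ I : Submodule ℂ V,
    (∀ (u : V) (n : ℤ), ∀ x ∈ I, 𝒱.mode u n x ∈ I) → I = ⊥ ∨ I = ⊤

/-- The `0`-th product `[uv] = u(0)v`. -/
def bracket : V →ₗ[ℂ] V →ₗ[ℂ] V := vertexMode 𝒱.Y 0

/-- The `0`-th product makes `V` a left Leibniz algebra. -/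
theorem isLeftLeibniz_bracket : LeibnizAlg.IsLeftLeibniz 𝒱.bracket := by
  intro a b c
  have h := 𝒱.jacobi a b c 0 0 0
  rw [finsum_eq_single _ 0, finsum_eq_single _ 0, finsum_eq_single _ 0] at h
  · simp at h
    exact (eq_add_of_sub_eq h.symm)
  all_goals
    intro i hi
    simp [Ring.choose_zero_ite, hi]

/-- The Leibniz kernel `N` of `V_1`: the span of all `a(0)a` with `a ∈ V_1`. -/
def leibnizKernel : Submodule ℂ V :=
  Submodule.span ℂ {x | ∃ a ∈ 𝒱.weightSpace 1, x = 𝒱.bracket a a}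

/-- The annihilator `F = {a ∈ V_1 | a(0)N = 0}` of the Leibniz kernel. -/
def kernelAnnihilator : Submodule ℂ V where
  carrier := {a | a ∈ 𝒱.weightSpace 1 ∧ ∀ x ∈ 𝒱.leibnizKernel, 𝒱.bracket a x = 0}
  zero_mem' := ⟨Submodule.zero_mem _, fun x _ => by simp⟩
  add_mem' := fun ha hb =>
    ⟨Submodule.add_mem _ ha.1 hb.1, fun x hx => by simp [ha.2 x hx, hb.2 x hx]⟩
  smul_mem' := fun t _ ha =>
    ⟨Submodule.smul_mem _ t ha.1, fun x hx => by simp [ha.2 x hx]⟩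

/-- `S` is a Levi subalgebra of the Leibniz algebra `F`. -/
def IsLevi (S : Submodule ℂ V) : Prop :=
  LeibnizAlg.IsLeviSubalgebra 𝒱.isLeftLeibniz_bracket 𝒱.kernelAnnihilator S

/-- The automorphism group `Aut(V)`: the linear automorphisms of `V` that fix `𝟏` and `ω` and
respect all products `u(n)v`. -/
def aut : Subgroup (V ≃ₗ[ℂ] V) where
  carrier := {g | g 𝒱.vacuum = 𝒱.vacuum ∧ g 𝒱.conformal = 𝒱.conformal ∧
    ∀ (u v : V) (n : ℤ), g (𝒱.mode u n v) = 𝒱.mode (g u) n (g v)}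
  one_mem' := ⟨rfl, rfl, fun _ _ _ => rfl⟩
  mul_mem' := by
    rintro g h ⟨g1, g2, g3⟩ ⟨h1, h2, h3⟩
    exact ⟨by simp [h1, g1], by simp [h2, g2], fun u v n => by simp [h3, g3]⟩
  inv_mem' := by
    rintro g ⟨g1, g2, g3⟩
    refine ⟨g.injective ?_, g.injective ?_, fun u v n => g.injective ?_⟩
    · exact (g.apply_symm_apply _).trans g1.symm
    · exact (g.apply_symm_apply _).trans g2.symm
    · rw [g3]
      change g (g.symm _) = 𝒱.mode (g (g.symm u)) n (g (g.symm v))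
      simp

end VertexOperatorAlgebra

end

/-! ### Whitehead's first lemma. -/

namespace LieAlgebra

open LieModule Module

section Perfect

variable (K L : Type*) [Field K] [LieRing L] [LieAlgebra K L] [Module.Finite K L] [IsKilling K L]

/-! The plan is Malcev's conjugacy argument, with the exponentials of zeroth modes `a(0)` as inner
automorphisms. Two obstacles are that `F` is only a Leibniz algebra, and that `exp a(0)` fixes `ω`
only when `a(0)ω = 0`.

Perfectness of a Levi subalgebra `S` overcomes both. Let `z` have weight zero. As `(L(-1)z)(0) = 0`,
the vector `v(0)L(-1)z` lies in `N` for `v ∈ S`, and `u(0)` kills it for `u ∈ S`. Since `S = [S,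
S]`, every `x ∈ S` satisfies `x(0)L(-1)z = 0`. Hence `x(0)z` is in the kernel of `L(-1)`, which is
`ℂ𝟏` by a Schur argument in the simple algebra `V` (`IsSimple.exists_smul_vacuum`), and perfectness
gives `x(0)z = 0`. Descending in the weight, and then writing `x` as a bracket once more, one finds
that `x(n)` with `n ≥ 0` kills every vector of weight at most zero
(`mode_eq_zero_of_weight_nonpos`).

For (b), this yields `u(k)v = 0` for `k ≥ 2`; skew-symmetry then gives `L(-1)u(1)v = 0`, so `u(1)v ∈
ℂ𝟏`, and the commutator formula is the affine relation.

For (a), it shows that elements of `[S, V₁]` are primary, so their exponentials are automorphisms.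
Whitehead's first lemma finds the conjugating elements there (`IsLeviSubalgebra.exists_ad_mod`), one
step of the derived series of the radical at a time, always modulo `N`, because the bracket of `F`
is antisymmetric only modulo `N`. The remaining `N` is harmless: it brackets to zero with `F` on
both sides, and Levi subalgebras are perfect. -/

theorem IsKilling.lie_top_top : (⁅(⊤ : LieIdeal K L), (⊤ : LieIdeal K L)⁆ : LieIdeal K L) = ⊤ := by
  set D : LieIdeal K L := ⁅(⊤ : LieIdeal K L), (⊤ : LieIdeal K L)⁆
  have h := LieIdeal.isCompl_killingCompl (K := K) D
  suffices D.killingCompl = ⊥ by simpa [this] using h.sup_eq_top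
  rw [LieSubmodule.eq_bot_iff]
  intro x hx
  rw [← LieSubmodule.mem_bot (R := K) (L := L), ← center_eq_bot K L]
  rw [LieModule.mem_maxTrivSubmodule]
  intro y
  -- By invariance, pairing `⁅y, x⁆` with `z` is, up to sign, pairing `x` with `⁅y, z⁆ ∈ D`.
  -- Nondegeneracy then makes `x` central.
  have : ⁅y, x⁆ ∈ LinearMap.ker (killingForm K L) := by
    rw [LinearMap.mem_ker]
    ext z
    rw [LieModule.traceForm_apply_lie_apply', LieModule.traceForm_comm]
    have := (LieIdeal.mem_killingCompl K L D).1 hx ⁅y, z⁆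
      (LieSubmodule.lie_mem_lie (LieSubmodule.mem_top y) (LieSubmodule.mem_top z))
    simpa using this
  rwa [IsKilling.ker_killingForm_eq_bot, Submodule.mem_bot] at this

end Perfect

section Casimir

variable {K L M : Type*} [Field K] [LieRing L] [LieAlgebra K L]
  [AddCommGroup M] [Module K M]

/-- If `b` and `c` are dual bases with respect to an invariant bilinear form on an ideal, then
the tensor `∑ b i ⊗ c i` is invariant. -/
theorem sum_dual_invariant {ι : Type*} [Fintype ι] [DecidableEq ι] {I : Type*} [AddCommGroup I]
    [Module K I] [LieRingModule L I] [LieModule K L I]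
    (B : LinearMap.BilinForm K I) (hinv : ∀ (x : L) (y z : I), B ⁅x, y⁆ z = - B y ⁅x, z⁆)
    (b c : Module.Basis ι K I) (hbc : ∀ i j, B (b i) (c j) = if i = j then 1 else 0)
    (f : I →ₗ[K] I →ₗ[K] M) (x : L) :
    ∑ i, (f ⁅x, b i⁆ (c i) + f (b i) ⁅x, c i⁆) = 0 := by
  have hb : ∀ y : I, y = ∑ j, B y (c j) • b j := by
    intro y
    conv_lhs => rw [← b.sum_repr y]
    refine Finset.sum_congr rfl fun j _ => ?_
    congr 1
    conv_rhs => rw [← b.sum_repr y]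
    simp only [map_sum, map_smul, LinearMap.sum_apply, LinearMap.smul_apply, hbc, smul_eq_mul,
      mul_ite, mul_one, mul_zero, Finset.sum_ite_eq', Finset.mem_univ, if_true]
  have hc : ∀ y : I, y = ∑ j, B (b j) y • c j := by
    intro y
    conv_lhs => rw [← c.sum_repr y]
    refine Finset.sum_congr rfl fun j _ => ?_
    congr 1
    conv_rhs => rw [← c.sum_repr y]
    simp only [map_sum, map_smul, hbc, smul_eq_mul, mul_ite, mul_one, mul_zero,
      Finset.sum_ite_eq, Finset.mem_univ, if_true]
  have h1 : ∀ i, f ⁅x, b i⁆ (c i) = ∑ j, B ⁅x, b i⁆ (c j) • f (b j) (c i) := by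
    intro i
    conv_lhs => rw [hb ⁅x, b i⁆]
    simp
  have h2 : ∀ i, f (b i) ⁅x, c i⁆ = ∑ j, B (b j) ⁅x, c i⁆ • f (b i) (c j) := by
    intro i
    conv_lhs => rw [hc ⁅x, c i⁆]
    simp
  rw [Finset.sum_add_distrib]
  simp_rw [h1, h2]
  rw [Finset.sum_comm (f := fun i j => B ⁅x, b i⁆ (c j) • f (b j) (c i)),
    ← Finset.sum_add_distrib]
  refine Finset.sum_eq_zero fun i _ => ?_
  rw [← Finset.sum_add_distrib]
  refine Finset.sum_eq_zero fun j _ => ?_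
  rw [hinv, neg_smul, neg_add_cancel]

end Casimir

section Whitehead

variable {K L M : Type*} [Field K] [CharZero K] [LieRing L] [LieAlgebra K L] [Module.Finite K L]
  [IsKilling K L]
  [AddCommGroup M] [Module K M] [Module.Finite K M] [LieRingModule L M] [LieModule K L M]

omit [CharZero K] in
theorem lie_induction {p : L → Prop} (h0 : p 0) (hadd : ∀ x y, p x → p y → p (x + y))
    (hlie : ∀ x y : L, p ⁅x, y⁆) (hsmul : ∀ (t : K) x, p x → p (t • x)) (x : L) : p x := by
  have hx : x ∈ (⁅(⊤ : LieIdeal K L), (⊤ : LieIdeal K L)⁆ : LieIdeal K L) := by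
    rw [IsKilling.lie_top_top]; trivial
  rw [← LieSubmodule.mem_toSubmodule, LieSubmodule.lieIdeal_oper_eq_linear_span'] at hx
  induction hx using Submodule.span_induction with
  | mem x h => obtain ⟨y, -, z, -, rfl⟩ := h; exact hlie y z
  | zero => exact h0
  | add x y _ _ hx hy => exact hadd x y hx hy
  | smul t x _ hx => exact hsmul t x hx

/-- A zero trace form makes the derived algebra act nilpotently. Here that is all of `L`, so Engel's
theorem provides a nonzero invariant vector, and irreducibility does the rest. -/
theorem isTrivial_of_traceForm_eq_zero [LieModule.IsIrreducible K L M]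
    (h : traceForm K L M = 0) (x : L) (m : M) : ⁅x, m⁆ = 0 := by
  have h1 := LieModule.isNilpotent_derivedSeries_of_traceForm_eq_zero (R := K) (L := L) (M := M) h
  have h2 : LieModule.IsNilpotent L M := by
    rw [LieModule.isNilpotent_iff_forall' (R := K)] at h1 ⊢
    intro y
    refine h1 ⟨y, ?_⟩
    have : derivedSeries K L 1 = ⊤ := by
      simpa [derivedSeries_def] using IsKilling.lie_top_top K L
    rw [this]; trivial
  have h3 : Nontrivial M := LieModule.nontrivial_of_isIrreducible K L M
  have h4 := LieModule.nontrivial_max_triv_of_isNilpotent K L M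
  have h5 := (maxTrivSubmodule K L M).eq_top_of_isIrreducible K L M
  have : m ∈ maxTrivSubmodule K L M := by rw [h5]; trivial
  exact (LieModule.mem_maxTrivSubmodule K L M m).1 this x

/-- The kernel of the trace form of a Lie module, as an ideal. -/
noncomputable def traceFormKer (K L M : Type*) [Field K] [LieRing L] [LieAlgebra K L]
    [AddCommGroup M] [Module K M] [LieRingModule L M] [LieModule K L M] : LieIdeal K L where
  __ := LinearMap.ker (traceForm K L M)
  lie_mem {x m} hm := by
    have hm : traceForm K L M m = 0 := hm
    change traceForm K L M ⁅x, m⁆ = 0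
    ext z
    rw [LieModule.traceForm_apply_lie_apply', hm]
    simp

theorem exists_primitive_of_isIrreducible [LieModule.IsIrreducible K L M] (d : L →ₗ[K] M)
    (hd : ∀ x y, d ⁅x, y⁆ = ⁅x, d y⁆ - ⁅y, d x⁆) : ∃ m, ∀ x, d x = ⁅x, m⁆ := by
  by_cases h : traceForm K L M = 0
  · have htriv := isTrivial_of_traceForm_eq_zero h
    refine ⟨0, fun x => ?_⟩
    rw [lie_zero]
    refine lie_induction (K := K) (p := fun x => d x = 0) ?_ ?_ ?_ ?_ x
    · simp
    · intro x y hx hy; simp [hx, hy]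
    · intro x y; simp [hd, htriv]
    · intro t x hx; simp [hx]
  classical
  set τ := traceForm K L M
  set I := traceFormKer K L M
  -- The trace form is nondegenerate on the Killing complement `J` of its kernel; dual bases of `J`
  -- define the Casimir operator `C`.
  have hcompl := LieIdeal.isCompl_killingCompl (K := K) I
  set J := I.killingCompl
  have hI : ∀ x ∈ I, ∀ y, τ x y = 0 := by
    intro x hx y
    have hx : τ x = 0 := hx
    simp [hx]
  let B : LinearMap.BilinForm K J := τ.restrict J.toSubmodule
  have hB : ∀ x y : J, B x y = τ x y := fun x y => rfl
  have hBsymm : B.IsSymm := ⟨fun x y => LieModule.traceForm_comm K L M x y⟩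
  have hBnd : B.Nondegenerate := by
    refine (LinearMap.IsRefl.nondegenerate_iff_separatingLeft (B := B) hBsymm.isRefl).2 ?_
    intro x hx
    have hxI : (x : L) ∈ I := by
      change τ x = 0
      ext y
      have hy : y ∈ I ⊔ J := by rw [hcompl.sup_eq_top]; trivial
      rw [LieSubmodule.mem_sup] at hy
      obtain ⟨i, hi, j, hj, rfl⟩ := hy
      rw [map_add, LieModule.traceForm_comm, hI i hi]
      exact (zero_add _).trans (hx ⟨j, hj⟩)
    have : (x : L) ∈ I ⊓ J := ⟨hxI, x.2⟩
    rw [hcompl.inf_eq_bot, LieSubmodule.mem_bot] at this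
    exact Subtype.ext this
  have hinv : ∀ (x : L) (y z : J), B ⁅x, y⁆ z = - B y ⁅x, z⁆ := by
    intro x y z
    rw [hB, hB]
    exact LieModule.traceForm_apply_lie_apply' K L M x y z
  let b := Module.finBasis K J
  let c := B.dualBasis hBnd b
  have hbc : ∀ i j, B (b i) (c j) = if i = j then 1 else 0 :=
    LinearMap.BilinForm.apply_dualBasis_right hBnd hBsymm b
  let C : M →ₗ[K] M := ∑ i, toEnd K L M (b i) * toEnd K L M (c i)
  have hC : ∀ m, C m = ∑ i, ⁅(b i : L), ⁅(c i : L), m⁆⁆ := by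
    intro m; simp [C]
  have htr : LinearMap.trace K M C = Module.finrank K J := by
    have : ∀ i, LinearMap.trace K M (toEnd K L M (b i) * toEnd K L M (c i)) = 1 := by
      intro i
      have := hbc i i
      rw [hB, LieModule.traceForm_apply_apply] at this
      rw [Module.End.mul_eq_comp]
      simpa using this
    rw [map_sum, Finset.sum_congr rfl fun i _ => this i]
    simp
  have hCinv : ∀ (x : L) m, ⁅x, C m⁆ = C ⁅x, m⁆ := by
    intro x m
    let f : J →ₗ[K] J →ₗ[K] M := LinearMap.mk₂ K (fun y z => ⁅(y : L), ⁅(z : L), m⁆⁆)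
      (by simp) (by simp) (by simp) (by simp)
    rw [hC, hC, lie_sum, ← sub_eq_zero, ← Finset.sum_sub_distrib]
    refine Eq.trans ?_ (sum_dual_invariant B hinv b c hbc f x)
    refine Finset.sum_congr rfl fun i _ => ?_
    simp only [f, LinearMap.mk₂_apply, LieSubmodule.coe_bracket]
    rw [lie_lie x (b i : L), lie_lie x (c i : L), lie_sub]
    abel
  let k : LieSubmodule K L M :=
    { LinearMap.ker C with
      lie_mem := by
        intro x m hm
        have hm : C m = 0 := hm
        change C ⁅x, m⁆ = 0
        rw [← hCinv, hm, lie_zero] }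
  -- Schur: if `C = 0`, then its trace `dim J` vanishes and so does the trace form, which was
  -- excluded.
  have hk : k = ⊥ := by
    rcases IsSimpleOrder.eq_bot_or_eq_top k with hk | hk
    · exact hk
    exfalso
    have hC0 : C = 0 := by
      ext m
      have : m ∈ k := by rw [hk]; trivial
      exact this
    rw [hC0, map_zero] at htr
    have hJ : Module.finrank K J = 0 := by exact_mod_cast htr.symm
    have hJ : J = ⊥ := by
      by_contra hne
      have := (LieSubmodule.nontrivial_iff_ne_bot K L L).2 hne
      exact Module.finrank_pos.ne' hJ
    have hIt : I = ⊤ := by simpa [hJ] using hcompl.sup_eq_top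
    apply h
    ext x y
    simpa using hI x (by rw [hIt]; trivial) y
  have hinj : Function.Injective C := by
    rw [← LinearMap.ker_eq_bot]
    have : k.toSubmodule = ⊥ := by rw [hk]; rfl
    exact this
  have hsurj : Function.Surjective C := LinearMap.injective_iff_surjective.1 hinj
  -- If `d x = ⁅x, m⁆` for all `x`, then `∑ ⁅b i, d (c i)⁆ = C m`; this dictates the choice of `m`.
  obtain ⟨m, hm⟩ := hsurj (∑ i, ⁅(b i : L), d (c i)⁆)
  refine ⟨m, fun x => hinj ?_⟩
  rw [← hCinv, hm, hC, lie_sum, ← sub_eq_zero, ← Finset.sum_sub_distrib]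
  let f : J →ₗ[K] J →ₗ[K] M := LinearMap.mk₂ K (fun y z => ⁅(y : L), d z⁆)
    (by simp) (by simp) (by simp) (by simp)
  rw [← neg_eq_zero, ← Finset.sum_neg_distrib]
  refine Eq.trans ?_ (sum_dual_invariant B hinv b c hbc f x)
  refine Finset.sum_congr rfl fun i _ => ?_
  simp only [f, LinearMap.mk₂_apply, LieSubmodule.coe_bracket]
  rw [hd, lie_lie x (b i : L), lie_sub]
  abel

end Whitehead

/-- **Whitehead's first lemma**: every 1-cocycle of a semisimple Lie algebra is a coboundary. -/
theorem exists_primitive {K L : Type*} [Field K] [CharZero K] [LieRing L]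
    [LieAlgebra K L] [Module.Finite K L] [IsKilling K L] {M : Type*} [AddCommGroup M] [Module K M]
    [Module.Finite K M] [LieRingModule L M] [LieModule K L M] (d : L →ₗ[K] M)
    (hd : ∀ x y, d ⁅x, y⁆ = ⁅x, d y⁆ - ⁅y, d x⁆) : ∃ m, ∀ x, d x = ⁅x, m⁆ := by
  induction hn : Module.finrank K M using Nat.strong_induction_on generalizing M with
  | _ n ih =>
  by_cases hM : Subsingleton M
  · exact ⟨0, fun x => Subsingleton.elim _ _⟩
  rw [not_subsingleton_iff_nontrivial] at hM
  by_cases hirr : ∀ N : LieSubmodule K L M, N ≠ ⊥ → N = ⊤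
  · have := LieModule.IsIrreducible.mk hirr
    exact exists_primitive_of_isIrreducible d hd
  push Not at hirr
  -- A primitive modulo `N` corrects `d` to a cocycle with values in `N`; both `M ⧸ N` and `N` have
  -- smaller dimension.
  obtain ⟨N, hN0, hN1⟩ := hirr
  have hlt : N.toSubmodule < ⊤ := by
    rw [lt_top_iff_ne_top]
    simpa using hN1
  have hpos : 0 < Module.finrank K N := by
    rw [Module.finrank_pos_iff, LieSubmodule.nontrivial_iff_ne_bot]
    exact hN0
  have hfin : Module.finrank K (M ⧸ N) + Module.finrank K N = Module.finrank K M :=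
    Submodule.finrank_quotient_add_finrank N.toSubmodule
  obtain ⟨q, hq⟩ := ih _ (by omega)
    ((LieSubmodule.Quotient.mk' N : M →ₗ[K] M ⧸ N) ∘ₗ d) (by
      intro x y
      simp only [LinearMap.comp_apply, LieModuleHom.coe_toLinearMap, ← LieModuleHom.map_lie, hd,
        map_sub]) rfl
  obtain ⟨m₀, rfl⟩ := LieSubmodule.Quotient.surjective_mk' N q
  have hmem : ∀ x, d x - ⁅x, m₀⁆ ∈ N := by
    intro x
    rw [← LieSubmodule.Quotient.mk_eq_zero']
    have := hq x
    simp only [LinearMap.comp_apply, LieModuleHom.coe_toLinearMap] at this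
    rw [← LieModuleHom.map_lie] at this
    change (LieSubmodule.Quotient.mk' N) _ = 0
    rw [map_sub, this, sub_self]
  let d' : L →ₗ[K] N := LinearMap.codRestrict N.toSubmodule
    (d - (LieModule.toEnd K L M : L →ₗ[K] Module.End K M).flip m₀) (by
      intro x; simpa using hmem x)
  have hd'c : ∀ x, (d' x : M) = d x - ⁅x, m₀⁆ := fun x => rfl
  obtain ⟨n, hn'⟩ := ih _ (by
      have := Submodule.finrank_lt hlt.ne
      rw [← hn]; exact this) d' (by
    intro x y
    apply Subtype.ext
    simp only [hd'c, LieSubmodule.coe_sub, LieSubmodule.coe_bracket, hd, lie_sub, lie_lie]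
    abel) rfl
  refine ⟨m₀ + n, fun x => ?_⟩
  have := congrArg (Subtype.val) (hn' x)
  rw [hd'c, LieSubmodule.coe_bracket] at this
  rw [lie_add, ← this]
  abel

end LieAlgebra

namespace LeibnizAlg

variable {L : Type*} [AddCommGroup L] [Module ℂ L] {β : L →ₗ[ℂ] L →ₗ[ℂ] L}

/-! ### Semisimple subalgebras of a Leibniz algebra. -/

section Semisimple

variable (hβ : IsLeftLeibniz β) {S : Submodule ℂ L} (hS : IsSubalgebra β S)
  (halt : ∀ a ∈ S, β a a = 0)
  (hss : @LieAlgebra.IsSemisimple ℂ S _ (lieRing hβ hS halt) (lieAlgebra hβ hS halt))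

include hss in
theorem map₂_self_of_isSemisimple [FiniteDimensional ℂ S] : Submodule.map₂ β S S = S := by
  let := lieRing hβ hS halt
  let := lieAlgebra hβ hS halt
  refine le_antisymm (Submodule.map₂_le.2 hS) fun s hs => ?_
  refine LieAlgebra.lie_induction (K := ℂ) (L := S) (p := fun x => (x : L) ∈ Submodule.map₂ β S S)
    ?_ ?_ ?_ ?_ ⟨s, hs⟩
  · exact Submodule.zero_mem _
  · exact fun x y hx hy => Submodule.add_mem _ hx hy
  · exact fun x y => Submodule.apply_mem_map₂ _ x.2 y.2
  · exact fun t x hx => Submodule.smul_mem _ t hx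

include hss in
/-- Whitehead's first lemma for a semisimple subalgebra of a Leibniz algebra acting on a
subquotient `P / J`. -/
theorem exists_primitive_mod [FiniteDimensional ℂ S] {J P : Submodule ℂ L} [FiniteDimensional ℂ P]
    (hJ : ∀ s ∈ S, ∀ x ∈ J, β s x ∈ J) (hP : ∀ s ∈ S, ∀ x ∈ P, β s x ∈ P) (d : S →ₗ[ℂ] L)
    (hd : ∀ s, d s ∈ P)
    (hcoc : ∀ s t : S, d ⟨β s t, hS s s.2 t t.2⟩ - (β s (d t) - β t (d s)) ∈ J) :
    ∃ m ∈ P, ∀ s : S, d s - β s m ∈ J := by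
  let := lieRing hβ hS halt
  let := lieAlgebra hβ hS halt
  let J' : Submodule ℂ P := J.comap P.subtype
  let r : S → P →ₗ[ℂ] P := fun s => (β s).restrict (hP s s.2)
  have hr : ∀ s, J' ≤ J'.comap (r s) := fun s x hx => hJ s s.2 x hx
  -- The left Leibniz identity says that left multiplication is a representation.
  let : LieRingModule S (P ⧸ J') :=
    { bracket := fun s m => J'.mapQ J' (r s) (hr s) m
      add_lie := by
        intro s t m
        obtain ⟨p, rfl⟩ := Submodule.Quotient.mk_surjective _ m
        exact congrArg J'.mkQ (Subtype.ext (by simp [r]))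
      lie_add := fun s m n => map_add _ _ _
      leibniz_lie := by
        intro s t m
        obtain ⟨p, rfl⟩ := Submodule.Quotient.mk_surjective _ m
        exact congrArg J'.mkQ (Subtype.ext (hβ s t p)) }
  let : LieModule ℂ S (P ⧸ J') :=
    { smul_lie := by
        intro c s m
        obtain ⟨p, rfl⟩ := Submodule.Quotient.mk_surjective _ m
        exact congrArg J'.mkQ (Subtype.ext (by simp [r]))
      lie_smul := fun c s m => map_smul _ _ _ }
  obtain ⟨m, hm⟩ := LieAlgebra.exists_primitive (K := ℂ) (L := S) (M := P ⧸ J')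
    (J'.mkQ ∘ₗ d.codRestrict P hd) (by
      intro s t
      rw [← sub_eq_zero]
      exact (Submodule.Quotient.mk_eq_zero J'
        (x := d.codRestrict P hd ⁅s, t⁆ - (r s (d.codRestrict P hd t)
          - r t (d.codRestrict P hd s)))).2 (hcoc s t))
  obtain ⟨p, rfl⟩ := Submodule.Quotient.mk_surjective _ m
  refine ⟨p, p.2, fun s => ?_⟩
  have := sub_eq_zero.2 (hm s)
  exact (Submodule.Quotient.mk_eq_zero J' (x := d.codRestrict P hd s - r s p)).1 this

end Semisimple

/-! ### Ideals and the solvable radical. -/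

section Ideal

variable {A I J : Submodule ℂ L}

theorem derivedSeries_mono (h : I ≤ J) (k : ℕ) : derivedSeries β I k ≤ derivedSeries β J k := by
  induction k with
  | zero => exact h
  | succ k ih => exact Submodule.map₂_le_map₂ ih ih

theorem derivedSeries_add (k l : ℕ) :
    derivedSeries β A (k + l) = derivedSeries β (derivedSeries β A k) l := by
  induction l with
  | zero => rfl
  | succ l ih => rw [← add_assoc, derivedSeries, derivedSeries, ih]

theorem IsIdealOf.map₂ (hβ : IsLeftLeibniz β) (h : IsIdealOf β A I) :
    IsIdealOf β A (Submodule.map₂ β I I) := by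
  refine ⟨Submodule.map₂_le.2 fun x hx y hy => h.1 (h.2 x (h.1 hx) y hy).1, fun a ha => ?_⟩
  suffices Submodule.map₂ β I I ≤ (Submodule.map₂ β I I).comap (β a) ⊓
      (Submodule.map₂ β I I).comap (β.flip a) from
    fun x hx => ⟨(this hx).1, (this hx).2⟩
  refine Submodule.map₂_le.2 fun x hx y hy => ⟨?_, ?_⟩
  · change β a (β x y) ∈ Submodule.map₂ β I I
    rw [hβ]
    exact Submodule.add_mem _ (Submodule.apply_mem_map₂ _ (h.2 a ha x hx).1 hy)
      (Submodule.apply_mem_map₂ _ hx (h.2 a ha y hy).1)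
  · have : β (β x y) a = β x (β y a) - β y (β x a) := by rw [hβ x y a]; abel
    change β (β x y) a ∈ Submodule.map₂ β I I
    rw [this]
    exact Submodule.sub_mem _ (Submodule.apply_mem_map₂ _ hx (h.2 a ha y hy).2)
      (Submodule.apply_mem_map₂ _ hy (h.2 a ha x hx).2)

theorem IsIdealOf.derivedSeries (hβ : IsLeftLeibniz β) (h : IsIdealOf β A I) (k : ℕ) :
    IsIdealOf β A (derivedSeries β I k) := by
  induction k with
  | zero => exact h
  | succ k ih => exact ih.map₂ hβ

theorem isIdealOf_sSup {s : Set (Submodule ℂ L)} (hs : ∀ I ∈ s, IsIdealOf β A I) :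
    IsIdealOf β A (sSup s) := by
  refine ⟨sSup_le fun I hI => (hs I hI).1, fun a ha => ?_⟩
  suffices sSup s ≤ (sSup s).comap (β a) ⊓ (sSup s).comap (β.flip a) from fun x hx => this hx
  exact sSup_le fun I hI x hx => ⟨le_sSup hI ((hs I hI).2 a ha x hx).1,
    le_sSup hI ((hs I hI).2 a ha x hx).2⟩

theorem IsIdealOf.sup (hI : IsIdealOf β A I) (hJ : IsIdealOf β A J) : IsIdealOf β A (I ⊔ J) := by
  rw [← sSup_pair]
  refine isIdealOf_sSup ?_
  rintro K (rfl | rfl)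
  exacts [hI, hJ]

/-- Modulo the ideal `J`, brackets in `I ⊔ J` depend only on the `I`-components. -/
theorem derivedSeries_sup_le (hI : IsIdealOf β A I) (hJ : IsIdealOf β A J) (k : ℕ) :
    derivedSeries β (I ⊔ J) k ≤ derivedSeries β I k ⊔ J := by
  have hle : ∀ k, LeibnizAlg.derivedSeries β I k ≤ A := by
    intro k
    refine le_trans ?_ hI.1
    induction k with
    | zero => exact le_rfl
    | succ k ih =>
      exact Submodule.map₂_le.2 fun x hx y hy => (hI.2 x (hI.1 (ih hx)) y (ih hy)).1
  induction k with
  | zero => exact le_rfl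
  | succ k ih =>
    refine (Submodule.map₂_le_map₂ ih ih).trans (Submodule.map₂_le.2 fun x hx y hy => ?_)
    obtain ⟨x, hx₀, x', hx', rfl⟩ := Submodule.mem_sup.1 hx
    obtain ⟨y, hy₀, y', hy', rfl⟩ := Submodule.mem_sup.1 hy
    rw [map_add β, LinearMap.add_apply, map_add (β x), add_assoc]
    refine Submodule.add_mem_sup (Submodule.apply_mem_map₂ _ hx₀ hy₀) (Submodule.add_mem _ ?_ ?_)
    · exact (hJ.2 x (hle k hx₀) y' hy').1
    · exact (hJ.2 (y + y') (add_mem (hle k hy₀) (hJ.1 hy')) x' hx').2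

theorem IsSolvable.sup (hI : IsIdealOf β A I) (hJ : IsIdealOf β A J) (hsI : IsSolvable β I)
    (hsJ : IsSolvable β J) : IsSolvable β (I ⊔ J) := by
  obtain ⟨k, hk⟩ := hsI
  obtain ⟨l, hl⟩ := hsJ
  refine ⟨k + l, le_bot_iff.1 ?_⟩
  rw [derivedSeries_add, ← hl]
  refine derivedSeries_mono ((derivedSeries_sup_le hI hJ k).trans ?_) l
  rw [hk, bot_sup_eq]

theorem IsSolvable.mono (h : I ≤ J) (hJ : IsSolvable β J) : IsSolvable β I := by
  obtain ⟨k, hk⟩ := hJ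
  exact ⟨k, le_bot_iff.1 ((derivedSeries_mono h k).trans hk.le)⟩

theorem isIdealOf_solvableRadical : IsIdealOf β A (solvableRadical β A) :=
  isIdealOf_sSup fun _ h => h.1

theorem le_solvableRadical (hI : IsIdealOf β A I) (hs : IsSolvable β I) :
    I ≤ solvableRadical β A := le_sSup ⟨hI, hs⟩

/-- Solvable ideals form a directed family, and a finite-dimensional subspace is a compact lattice
element, so a single solvable ideal already contains the supremum. -/
theorem isSolvable_solvableRadical [FiniteDimensional ℂ A] :
    IsSolvable β (solvableRadical β A) := by
  have hfin : FiniteDimensional ℂ (solvableRadical β A) :=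
    Submodule.finiteDimensional_of_le isIdealOf_solvableRadical.1
  have hc := (Submodule.fg_iff_compact _).1 ((Submodule.fg_top _).1 hfin.fg_top)
  obtain ⟨I, hI, hle⟩ := (CompleteLattice.isCompactElement_iff_le_of_directed_sSup_le _ _).1 hc
    {I : Submodule ℂ L | IsIdealOf β A I ∧ IsSolvable β I}
    ⟨⊥, ⟨bot_le, fun a _ x hx => by
      rw [Submodule.mem_bot] at hx
      simp [hx]⟩, 0, rfl⟩
    (fun I hI J hJ => ⟨I ⊔ J, ⟨hI.1.sup hJ.1, .sup hI.1 hJ.1 hI.2 hJ.2⟩, le_sup_left,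
      le_sup_right⟩) le_rfl
  exact hI.2.mono hle

end Ideal

/-! ### Transport along automorphisms. -/

section Map

variable (g : L ≃ₗ[ℂ] L) (hg : ∀ a b, g (β a b) = β (g a) (g b))

include hg in
theorem map_map₂ (I J : Submodule ℂ L) :
    (Submodule.map₂ β I J).map (g : L →ₗ[ℂ] L) =
      Submodule.map₂ β (I.map (g : L →ₗ[ℂ] L)) (J.map (g : L →ₗ[ℂ] L)) := by
  rw [Submodule.map_map₂, Submodule.map₂_map_map]
  congr 1
  ext a b
  exact hg a b

include hg in
theorem map_derivedSeries (I : Submodule ℂ L) (k : ℕ) :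
    (derivedSeries β I k).map (g : L →ₗ[ℂ] L) = derivedSeries β (I.map (g : L →ₗ[ℂ] L)) k := by
  induction k with
  | zero => rfl
  | succ k ih => rw [derivedSeries, derivedSeries, map_map₂ g hg, ih]

include hg in
theorem IsIdealOf.map {A I : Submodule ℂ L} (h : IsIdealOf β A I) :
    IsIdealOf β (A.map (g : L →ₗ[ℂ] L)) (I.map (g : L →ₗ[ℂ] L)) := by
  refine ⟨Submodule.map_mono h.1, ?_⟩
  rintro _ ⟨a, ha, rfl⟩ _ ⟨x, hx, rfl⟩
  exact ⟨⟨β a x, (h.2 a ha x hx).1, hg a x⟩, ⟨β x a, (h.2 a ha x hx).2, hg x a⟩⟩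

include hg in
theorem map_solvableRadical_le (A : Submodule ℂ L) :
    (solvableRadical β A).map (g : L →ₗ[ℂ] L) ≤ solvableRadical β (A.map (g : L →ₗ[ℂ] L)) := by
  rw [Submodule.map_le_iff_le_comap]
  refine sSup_le fun I hI => ?_
  rw [← Submodule.map_le_iff_le_comap]
  refine le_solvableRadical (hI.1.map g hg) ?_
  obtain ⟨k, hk⟩ := hI.2
  exact ⟨k, by rw [← map_derivedSeries g hg, hk, Submodule.map_bot]⟩

include hg in
theorem map_solvableRadical (A : Submodule ℂ L) :
    (solvableRadical β A).map (g : L →ₗ[ℂ] L) = solvableRadical β (A.map (g : L →ₗ[ℂ] L)) := by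
  refine le_antisymm (map_solvableRadical_le g hg A) ?_
  have h := map_solvableRadical_le (β := β) g.symm
    (fun a b => g.injective (by simp [hg])) (A.map (g : L →ₗ[ℂ] L))
  have key : ∀ B : Submodule ℂ L,
      (B.map (g : L →ₗ[ℂ] L)).map (g.symm : L →ₗ[ℂ] L) = B := by
    intro B
    rw [← Submodule.map_comp]
    convert Submodule.map_id B
    ext; simp
  have key' : ∀ B : Submodule ℂ L,
      (B.map (g.symm : L →ₗ[ℂ] L)).map (g : L →ₗ[ℂ] L) = B := by
    intro B
    rw [← Submodule.map_comp]
    convert Submodule.map_id B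
    ext; simp
  rw [key] at h
  have h2 := Submodule.map_mono (f := (g : L →ₗ[ℂ] L)) h
  rwa [key'] at h2

include hg in
theorem IsLeviSubalgebra.map {hβ : IsLeftLeibniz β} {A S : Submodule ℂ L}
    [FiniteDimensional ℂ S] (h : IsLeviSubalgebra hβ A S) :
    IsLeviSubalgebra hβ (A.map (g : L →ₗ[ℂ] L)) (S.map (g : L →ₗ[ℂ] L)) := by
  have hsub : IsSubalgebra β (S.map (g : L →ₗ[ℂ] L)) := by
    rintro _ ⟨a, ha, rfl⟩ _ ⟨b, hb, rfl⟩
    exact ⟨β a b, h.isSubalgebra a ha b hb, hg a b⟩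
  have halt : ∀ a ∈ S.map (g : L →ₗ[ℂ] L), β a a = 0 := by
    rintro _ ⟨a, ha, rfl⟩
    exact (hg a a).symm.trans (by rw [h.alternating a ha, map_zero])
  refine ⟨hsub, halt, ?_, ?_, ?_⟩
  · let := lieRing hβ h.isSubalgebra h.alternating
    let := lieAlgebra hβ h.isSubalgebra h.alternating
    let := lieRing hβ hsub halt
    let := lieAlgebra hβ hsub halt
    have := h.isSemisimple
    let e : S ≃ₗ⁅ℂ⁆ S.map (g : L →ₗ[ℂ] L) :=
      { g.submoduleMap S with map_lie' := fun {a b} => Subtype.ext (hg a b) }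
    have : LieAlgebra.IsKilling ℂ (S.map (g : L →ₗ[ℂ] L)) := LieAlgebra.isKilling_of_equiv e
    infer_instance
  · rw [← map_solvableRadical g hg, ← Submodule.map_inf _ g.injective, h.inf_eq, Submodule.map_bot]
  · rw [← map_solvableRadical g hg, ← Submodule.map_sup, h.sup_eq]

end Map

end LeibnizAlg

namespace LeibnizAlg

variable {L : Type*} [AddCommGroup L] [Module ℂ L] {β : L →ₗ[ℂ] L →ₗ[ℂ] L}

/-! ### Malcev's conjugation step. -/

section Malcev

variable {hβ : IsLeftLeibniz β} {F : Submodule ℂ L} {S S₁ S₂ : Submodule ℂ L}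

theorem IsLeviSubalgebra.le (h : IsLeviSubalgebra hβ F S) : S ≤ F :=
  le_sup_left.trans_eq h.sup_eq

theorem IsLeviSubalgebra.map₂_self [FiniteDimensional ℂ F] (h : IsLeviSubalgebra hβ F S) :
    Submodule.map₂ β S S = S :=
  have := Submodule.finiteDimensional_of_le h.le
  map₂_self_of_isSemisimple hβ h.isSubalgebra h.alternating h.isSemisimple

/-- The infinitesimal step in the conjugation of two Levi subalgebras: if they agree modulo an ideal
`I` of the radical, then they agree modulo `J ⊇ [I, I]` after applying `1 + ad a` for some
`a ∈ [S₁, I]`. -/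
theorem IsLeviSubalgebra.exists_ad_mod [FiniteDimensional ℂ F] {I J : Submodule ℂ L}
    (h₁ : IsLeviSubalgebra hβ F S₁) (h₂ : IsLeviSubalgebra hβ F S₂)
    (hsymm : ∀ a ∈ F, ∀ b ∈ F, β a b + β b a ∈ J) (hI : IsIdealOf β F I) (hJ : IsIdealOf β F J)
    (hII : Submodule.map₂ β I I ≤ J) (hIB : I ≤ solvableRadical β F) (hle : S₁ ≤ S₂ ⊔ I) :
    ∃ a ∈ Submodule.map₂ β S₁ I, ∀ s ∈ S₁, s + β a s ∈ S₂ ⊔ J := by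
  have hS₁ := h₁.le
  have hS₂ := h₂.le
  have := Submodule.finiteDimensional_of_le hS₁
  obtain ⟨C, hSC, hBC⟩ : ∃ C, S₂ ≤ C ∧ IsCompl (solvableRadical β F) C := by
    obtain ⟨C, hC, hc⟩ := (disjoint_iff.2 h₂.inf_eq).exists_isCompl
    exact ⟨C, hC, hc.symm⟩
  -- `p` kills `S₂` and fixes `I`, so on `S₁ ≤ S₂ ⊔ I` it extracts the `I`-component.
  set p := (solvableRadical β F).projection C hBC
  have hp0 : ∀ t ∈ S₂, p t = 0 := fun t ht =>
    (Submodule.projection_apply_eq_zero_iff hBC).2 (hSC ht)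
  have hp1 : ∀ x ∈ I, p x = x := fun x hx => Submodule.projection_apply_of_mem_left hBC (hIB hx)
  have hdec : ∀ s ∈ S₁, p s ∈ I ∧ s - p s ∈ S₂ := by
    intro s hs
    obtain ⟨t, ht, x, hx, rfl⟩ := Submodule.mem_sup.1 (hle hs)
    rw [map_add, hp0 t ht, hp1 x hx, zero_add, add_sub_cancel_right]
    exact ⟨hx, ht⟩
  -- Modulo `J` the bracket is antisymmetric and `[I, I]` vanishes, so `p` is a 1-cocycle on `S₁`.
  have hcoc : ∀ s ∈ S₁, ∀ t ∈ S₁, p (β s t) - (β s (p t) - β t (p s)) ∈ J := by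
    intro s hs t ht
    obtain ⟨hd, hσ⟩ := hdec s hs
    obtain ⟨he, hτ⟩ := hdec t ht
    set d := p s
    set e := p t
    obtain ⟨σ, hσd⟩ : ∃ σ, σ = s - d := ⟨_, rfl⟩
    obtain ⟨τ, hτe⟩ : ∃ τ, τ = t - e := ⟨_, rfl⟩
    rw [← hσd] at hσ
    rw [← hτe] at hτ
    have hs' : s = σ + d := by rw [hσd]; abel
    have ht' : t = τ + e := by rw [hτe]; abel
    have h1 : p (β s t) = β σ e + β d τ + β d e := by
      rw [hs', ht']
      simp only [map_add, LinearMap.add_apply]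
      rw [hp0 _ (h₂.isSubalgebra σ hσ τ hτ), hp1 _ (hI.2 σ (hS₂ hσ) e he).1,
        hp1 _ (hI.2 τ (hS₂ hτ) d hd).2, hp1 _ (hI.2 e (hI.1 he) d hd).2]
      abel
    have h2 : p (β s t) - (β s e - β t d) = (β d τ + β τ d) + β e d := by
      rw [h1, hs', ht']
      simp only [map_add, LinearMap.add_apply]
      abel
    rw [h2]
    exact J.add_mem (hsymm d (hI.1 hd) τ (hS₂ hτ)) (hII (Submodule.apply_mem_map₂ _ he hd))
  -- Using `P` instead of `I` places the primitive in `[S₁, I]` modulo `J`; perfectness of `S₁`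
  -- ensures that `p` maps it into `P`.
  set P := Submodule.map₂ β S₁ I ⊔ J
  have hJP : J ≤ P := le_sup_right
  have hMI : Submodule.map₂ β S₁ I ≤ I :=
    Submodule.map₂_le.2 fun s hs x hx => (hI.2 s (hS₁ hs) x hx).1
  have hMP : ∀ s ∈ S₁, ∀ x ∈ I, β s x ∈ P := fun s hs x hx =>
    Submodule.mem_sup_left (Submodule.apply_mem_map₂ _ hs hx)
  have hPF : P ≤ F := sup_le (hMI.trans hI.1) hJ.1
  have := Submodule.finiteDimensional_of_le hPF
  have hJinv : ∀ s ∈ S₁, ∀ x ∈ J, β s x ∈ J := fun s hs x hx => (hJ.2 s (hS₁ hs) x hx).1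
  have hPinv : ∀ s ∈ S₁, ∀ x ∈ P, β s x ∈ P := by
    intro s hs x hx
    obtain ⟨y, hy, j, hj, rfl⟩ := Submodule.mem_sup.1 hx
    rw [map_add]
    exact P.add_mem (hMP s hs y (hMI hy)) (hJP (hJinv s hs j hj))
  have hpP : ∀ s ∈ S₁, p s ∈ P := by
    intro s hs
    have key : Submodule.map₂ β S₁ S₁ ≤ P.comap p := by
      refine Submodule.map₂_le.2 fun s hs t ht => ?_
      have h3 : p (β s t) = (p (β s t) - (β s (p t) - β t (p s))) + β s (p t) - β t (p s) := by
        abel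
      rw [Submodule.mem_comap, h3]
      exact P.sub_mem (P.add_mem (hJP (hcoc s hs t ht)) (hMP s hs _ (hdec t ht).1))
        (hMP t ht _ (hdec s hs).1)
    rw [h₁.map₂_self] at key
    exact key hs
  obtain ⟨m, hm, hmd⟩ := exists_primitive_mod hβ h₁.isSubalgebra h₁.alternating h₁.isSemisimple
    hJinv hPinv (p ∘ₗ S₁.subtype) (fun s => hpP s s.2) (fun s t => hcoc s s.2 t t.2)
  obtain ⟨a, ha, j, hj, rfl⟩ := Submodule.mem_sup.1 hm
  have haI : a ∈ I := hMI ha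
  refine ⟨a, ha, fun s hs => ?_⟩
  have h4 : s + β a s = (s - p s) + ((p s - β s (a + j)) + β s j + (β a s + β s a)) := by
    rw [map_add]; abel
  rw [h4]
  refine Submodule.add_mem_sup (hdec s hs).2 (J.add_mem (J.add_mem (hmd ⟨s, hs⟩)
    (hJinv s hs j hj)) (hsymm a (hI.1 haI) s (hS₁ hs)))

/-- A Levi subalgebra contained in another one modulo a central subspace is equal to it. -/
theorem IsLeviSubalgebra.eq_of_le_sup [FiniteDimensional ℂ F] {N : Submodule ℂ L}
    (h₁ : IsLeviSubalgebra hβ F S₁) (h₂ : IsLeviSubalgebra hβ F S₂) (hN : N ≤ F)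
    (hNl : ∀ a ∈ F, ∀ x ∈ N, β a x = 0) (hNr : ∀ a ∈ F, ∀ x ∈ N, β x a = 0)
    (hle : S₁ ≤ S₂ ⊔ N) : S₁ = S₂ := by
  have h : S₁ ≤ S₂ := by
    rw [← h₁.map₂_self]
    refine Submodule.map₂_le.2 fun x hx y hy => ?_
    obtain ⟨s, hs, n, hn, rfl⟩ := Submodule.mem_sup.1 (hle hx)
    obtain ⟨t, ht, k, hk, rfl⟩ := Submodule.mem_sup.1 (hle hy)
    rw [map_add β, LinearMap.add_apply, hNr _ (F.add_mem (h₂.le ht) (hN hk)) n hn, map_add,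
      hNl s (h₂.le hs) k hk, add_zero, add_zero]
    exact h₂.isSubalgebra s hs t ht
  -- Both subalgebras complement the radical, so the inclusion is an equality.
  refine le_antisymm h fun t ht => ?_
  have htF := h₂.le ht
  rw [← h₁.sup_eq] at htF
  obtain ⟨s, hs, b, hb, rfl⟩ := Submodule.mem_sup.1 htF
  have hb2 : b ∈ S₂ ⊓ solvableRadical β F := ⟨by simpa using S₂.sub_mem ht (h hs), hb⟩
  rw [h₂.inf_eq, Submodule.mem_bot] at hb2
  simpa [hb2] using hs

end Malcev

end LeibnizAlg

namespace LinearMap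

open Module

/-! ### Exponentials of endomorphisms in finite dimension. -/

section Exp

open scoped Nat

variable {W W' : Type*} [AddCommGroup W] [Module ℂ W] [FiniteDimensional ℂ W]
  [AddCommGroup W'] [Module ℂ W'] [FiniteDimensional ℂ W']

/-- The exponential of an endomorphism of a finite-dimensional complex vector space. -/
noncomputable def finExp (T : End ℂ W) : End ℂ W :=
  Matrix.toLin (finBasis ℂ W) (finBasis ℂ W)
    (NormedSpace.exp (LinearMap.toMatrix (finBasis ℂ W) (finBasis ℂ W) T))

omit [FiniteDimensional ℂ W] in
theorem toLin_toMatrix_pow {ι : Type*} [Fintype ι] [DecidableEq ι] (b : Basis ι ℂ W) (T : End ℂ W)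
    (n : ℕ) : Matrix.toLin b b (LinearMap.toMatrix b b T ^ n) = T ^ n := by
  rw [LinearMap.toMatrix_pow, Matrix.toLin_toMatrix]

open scoped Matrix.Norms.Operator in
-- Testing against functionals turns the exponential series into scalar series, so `W` needs no
-- norm.
theorem hasSum_finExp (T : End ℂ W) (w : W) (f : W →ₗ[ℂ] ℂ) :
    HasSum (fun n : ℕ => ((n ! : ℂ)⁻¹) * f ((T ^ n) w)) (f (finExp T w)) := by
  let b := finBasis ℂ W
  let F : Matrix (Fin (finrank ℂ W)) (Fin (finrank ℂ W)) ℂ →ₗ[ℂ] ℂ :=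
    f ∘ₗ (LinearMap.applyₗ w) ∘ₗ (Matrix.toLin b b).toLinearMap
  have h := (NormedSpace.exp_series_hasSum_exp' (𝕂 := ℂ) (LinearMap.toMatrix b b T)).map F
    (LinearMap.continuous_of_finiteDimensional F)
  have hF : ∀ M, F M = f (Matrix.toLin b b M w) := fun _ => rfl
  have hs : (fun n : ℕ => ((n ! : ℂ)⁻¹) * f ((T ^ n) w)) =
      F ∘ fun n => ((n ! : ℂ)⁻¹) • LinearMap.toMatrix b b T ^ n := by
    funext n
    rw [Function.comp_apply, map_smul, hF, smul_eq_mul, ← toLin_toMatrix_pow b T n]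
  rw [hs]
  exact h

theorem finExp_add {T T' : End ℂ W} (h : Commute T T') :
    finExp (T + T') = finExp T * finExp T' := by
  have hc : Commute (LinearMap.toMatrix (finBasis ℂ W) (finBasis ℂ W) T)
      (LinearMap.toMatrix (finBasis ℂ W) (finBasis ℂ W) T') := by
    rw [Commute, SemiconjBy, ← LinearMap.toMatrix_mul, ← LinearMap.toMatrix_mul, h.eq]
  rw [finExp, map_add, Matrix.exp_add_of_commute _ _ hc,
    Matrix.toLin_mul (finBasis ℂ W) (finBasis ℂ W) (finBasis ℂ W)]
  rfl

theorem finExp_comp {T : End ℂ W} {T' : End ℂ W'} {A : W →ₗ[ℂ] W'} (h : A ∘ₗ T = T' ∘ₗ A) (w : W) :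
    A (finExp T w) = finExp T' (A w) := by
  have hpow : ∀ n : ℕ, ∀ w, A ((T ^ n) w) = (T' ^ n) (A w) := by
    intro n
    induction n with
    | zero => simp
    | succ n ih =>
      intro w
      rw [pow_succ, pow_succ, Module.End.mul_apply, Module.End.mul_apply, ih]
      exact congrArg _ (LinearMap.congr_fun h w)
  rw [← sub_eq_zero, ← forall_dual_apply_eq_zero_iff ℂ]
  intro f
  rw [map_sub, sub_eq_zero]
  refine (hasSum_finExp T w (f ∘ₗ A)).unique ?_
  simpa [hpow] using hasSum_finExp T' (A w) f

theorem finExp_of_apply_apply_eq_zero {T : End ℂ W} {w : W} (h : T (T w) = 0) :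
    finExp T w = w + T w := by
  rw [← sub_eq_zero, ← forall_dual_apply_eq_zero_iff ℂ]
  intro f
  rw [map_sub, sub_eq_zero]
  refine (hasSum_finExp T w f).unique ?_
  have := hasSum_sum_of_ne_finset_zero (f := fun n : ℕ => ((n ! : ℂ)⁻¹) * f ((T ^ n) w))
    (s := Finset.range 2) (L := .unconditional ℕ) (by
      intro n hn
      obtain ⟨k, rfl⟩ : ∃ k, n = k + 2 := ⟨n - 2, by simp at hn; omega⟩
      simp [pow_add, pow_two, h])
  simpa [Finset.sum_range_succ] using this

theorem finExp_zero : finExp (0 : End ℂ W) = 1 := by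
  ext w
  simp [finExp_of_apply_apply_eq_zero (T := (0 : End ℂ W)) (w := w) (by simp)]

theorem finExp_mul_neg (T : End ℂ W) : finExp T * finExp (-T) = 1 := by
  rw [← finExp_add (Commute.refl T).neg_right, add_neg_cancel, finExp_zero]

/-- If `J` is a `T`-stable subspace containing `T (T w)`, then `exp T w ≡ w + T w` modulo `J`. -/
theorem finExp_sub_mem {T : End ℂ W} {J : Submodule ℂ W} (hJ : J ≤ J.comap T) {w : W}
    (h : T (T w) ∈ J) : finExp T w - (w + T w) ∈ J := by
  have h1 := finExp_comp (T := T) (T' := J.mapQ J T hJ) (A := J.mkQ) (by ext; rfl) w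
  rw [finExp_of_apply_apply_eq_zero (T := J.mapQ J T hJ) (w := J.mkQ w)
    ((Submodule.Quotient.mk_eq_zero J (x := T (T w))).2 h)] at h1
  exact (Submodule.Quotient.mk_eq_zero J (x := finExp T w - (w + T w))).1 (sub_eq_zero.2 h1)

open scoped TensorProduct in
/-- The exponential turns derivations of a bilinear product into automorphisms. -/
theorem finExp_bilin {U : Type*} [AddCommGroup U] [Module ℂ U] [FiniteDimensional ℂ U]
    {T₁ : End ℂ W} {T₂ : End ℂ W'} {T₃ : End ℂ U} (B : W →ₗ[ℂ] W' →ₗ[ℂ] U)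
    (h : ∀ u v, T₃ (B u v) = B (T₁ u) v + B u (T₂ v)) (u : W) (v : W') :
    finExp T₃ (B u v) = B (finExp T₁ u) (finExp T₂ v) := by
  -- These commute, so the exponential of their sum is the product of exponentials; the Leibniz rule
  -- `h` says that `B` intertwines that sum with `T₃`.
  have hc : Commute (T₁.rTensor W') (T₂.lTensor W) := by
    rw [Commute, SemiconjBy, Module.End.mul_eq_comp, Module.End.mul_eq_comp,
      LinearMap.rTensor_comp_lTensor, LinearMap.lTensor_comp_rTensor]
  have h1 := finExp_comp (T := T₁.rTensor W' + T₂.lTensor W) (T' := T₃)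
    (A := TensorProduct.lift B) (by ext u v; simp [h]) (u ⊗ₜ v)
  have h2 : ∀ v, finExp (T₁.rTensor W') (u ⊗ₜ v) = finExp T₁ u ⊗ₜ v := fun v =>
    (finExp_comp (T := T₁) (T' := T₁.rTensor W') (A := (TensorProduct.mk ℂ W W').flip v)
      (by ext; simp) u).symm
  have h3 : finExp (T₂.lTensor W) (u ⊗ₜ v) = u ⊗ₜ finExp T₂ v :=
    (finExp_comp (T := T₂) (T' := T₂.lTensor W) (A := TensorProduct.mk ℂ W W' u)
      (by ext; simp) v).symm
  rw [TensorProduct.lift.tmul, finExp_add hc, Module.End.mul_apply, h3, h2,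
    TensorProduct.lift.tmul] at h1
  exact h1.symm

end Exp

/-! ### Exponentials on graded spaces. -/

section Graded

variable {V : Type*} [AddCommGroup V] [Module ℂ V] {ι : Type*} [DecidableEq ι]
  {𝒜 : ι → Submodule ℂ V}

theorem ext_of_isInternal (h𝒜 : DirectSum.IsInternal 𝒜) {M : Type*} [AddCommGroup M] [Module ℂ M]
    {f g : V →ₗ[ℂ] M} (h : ∀ i, ∀ v ∈ 𝒜 i, f v = g v) : f = g := by
  ext v
  have hv : v ∈ iSup 𝒜 := by rw [h𝒜.submodule_iSup_eq_top]; trivial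
  induction hv using Submodule.iSup_induction' with
  | mem i v hv => exact h i v hv
  | zero => simp
  | add v w _ _ hv hw => simp [hv, hw]

/-- An endomorphism of a graded space, given by its components. -/
noncomputable def ofGraded (h𝒜 : DirectSum.IsInternal 𝒜) (T : ∀ i, End ℂ (𝒜 i)) : End ℂ V :=
  DirectSum.toModule ℂ ι V (fun i => (𝒜 i).subtype ∘ₗ T i) ∘ₗ
    (LinearEquiv.ofBijective (DirectSum.coeLinearMap 𝒜) h𝒜).symm.toLinearMap

theorem ofGraded_apply (h𝒜 : DirectSum.IsInternal 𝒜) (T : ∀ i, End ℂ (𝒜 i)) (i : ι) (v : 𝒜 i) :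
    ofGraded h𝒜 T (v : V) = T i v := by
  have : (LinearEquiv.ofBijective (DirectSum.coeLinearMap 𝒜) h𝒜).symm (v : V) =
      DirectSum.lof ℂ ι (fun i => 𝒜 i) i v := by
    rw [LinearEquiv.symm_apply_eq]
    exact (DirectSum.coeLinearMap_lof 𝒜 i v).symm
  rw [ofGraded, LinearMap.comp_apply, LinearEquiv.coe_coe, this, DirectSum.toModule_lof]
  rfl

theorem ofGraded_comp_ofGraded (h𝒜 : DirectSum.IsInternal 𝒜) {T T' : ∀ i, End ℂ (𝒜 i)}
    (h : ∀ i, T i * T' i = 1) : ofGraded h𝒜 T ∘ₗ ofGraded h𝒜 T' = LinearMap.id := by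
  refine ext_of_isInternal h𝒜 fun i v hv => ?_
  rw [LinearMap.comp_apply, LinearMap.id_apply, ofGraded_apply h𝒜 T' i ⟨v, hv⟩, ofGraded_apply,
    ← Module.End.mul_apply, h, Module.End.one_apply]

/-- The exponential of a grading-preserving endomorphism of a graded space with finite-dimensional
homogeneous spaces. -/
noncomputable def gradedExp (h𝒜 : DirectSum.IsInternal 𝒜) [∀ i, FiniteDimensional ℂ (𝒜 i)]
    (D : End ℂ V) (hD : ∀ i, ∀ v ∈ 𝒜 i, D v ∈ 𝒜 i) : V ≃ₗ[ℂ] V :=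
  LinearEquiv.ofLinearMap (ofGraded h𝒜 fun i => finExp (D.restrict (hD i)))
    (ofGraded h𝒜 fun i => finExp (-D.restrict (hD i)))
    (ofGraded_comp_ofGraded h𝒜 fun i => finExp_mul_neg _)
    (ofGraded_comp_ofGraded h𝒜 fun i => by
      simpa using finExp_mul_neg (-D.restrict (hD i)))

theorem gradedExp_apply (h𝒜 : DirectSum.IsInternal 𝒜) [∀ i, FiniteDimensional ℂ (𝒜 i)]
    (D : End ℂ V) (hD : ∀ i, ∀ v ∈ 𝒜 i, D v ∈ 𝒜 i) (i : ι) (v : 𝒜 i) :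
    gradedExp h𝒜 D hD (v : V) = finExp (D.restrict (hD i)) v :=
  ofGraded_apply h𝒜 _ i v

end Graded

end LinearMap

namespace VertexOperatorAlgebra

variable {V : Type*} [AddCommGroup V] [Module ℂ V] (𝒱 : VertexOperatorAlgebra V)

/-! ### Commutator formula and skew-symmetry. -/

section Commutator

theorem mode_smul (c : ℂ) (u : V) (n : ℤ) : 𝒱.mode (c • u) n = c • 𝒱.mode u n := map_smul _ _ _

theorem mode_zero (n : ℤ) : 𝒱.mode 0 n = 0 := map_zero _

/-- The commutator formula. -/
theorem finsum_mode_eq_commutator (u v w : V) (p q : ℤ) :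
    ∑ᶠ i : ℕ, ((Ring.choose p i : ℤ) : ℂ) • 𝒱.mode (𝒱.mode u i v) (p + q - i) w =
      𝒱.mode u p (𝒱.mode v q w) - 𝒱.mode v q (𝒱.mode u p w) := by
  have h := 𝒱.jacobi u v w p q 0
  rw [finsum_eq_single (fun i : ℕ => ((-1 : ℂ) ^ i * ((Ring.choose (0 : ℤ) i : ℤ) : ℂ)) •
        vertexMode 𝒱.Y (p + 0 - i) u (vertexMode 𝒱.Y (q + i) v w)) 0,
    finsum_eq_single (fun i : ℕ => ((-1 : ℂ) ^ (0 : ℤ) * (-1 : ℂ) ^ i *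
      ((Ring.choose (0 : ℤ) i : ℤ) : ℂ)) •
        vertexMode 𝒱.Y (q + 0 - i) v (vertexMode 𝒱.Y (p + i) u w)) 0] at h
  · simpa using h
  all_goals
    intro i hi
    simp [Ring.choose_zero_ite, hi]

theorem commutator_eq_sum {u v : V} {k : ℕ} (h : ∀ i : ℕ, k ≤ i → 𝒱.mode u i v = 0) (w : V)
    (p q : ℤ) :
    𝒱.mode u p (𝒱.mode v q w) - 𝒱.mode v q (𝒱.mode u p w) =
      ∑ i ∈ Finset.range k,
        ((Ring.choose p i : ℤ) : ℂ) • 𝒱.mode (𝒱.mode u i v) (p + q - i) w := by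
  rw [← finsum_mode_eq_commutator]
  refine finsum_eq_sum_of_support_subset _ fun i hi => ?_
  by_contra hk
  simp only [Finset.coe_range, Set.mem_Iio, not_lt] at hk
  exact hi (by simp [h i hk])

theorem commutator_natCast (u v w : V) (m : ℕ) (q : ℤ) :
    𝒱.mode u m (𝒱.mode v q w) - 𝒱.mode v q (𝒱.mode u m w) =
      ∑ i ∈ Finset.range (m + 1),
        (m.choose i : ℂ) • 𝒱.mode (𝒱.mode u i v) (m + q - i) w := by
  rw [← finsum_mode_eq_commutator, finsum_eq_sum_of_support_subset (s := Finset.range (m + 1))]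
  · simp [Ring.choose_natCast]
  · intro i hi
    by_contra hk
    simp only [Finset.coe_range, Set.mem_Iio, not_lt] at hk
    exact hi (by simp [Ring.choose_natCast, Nat.choose_eq_zero_of_lt hk])

theorem mode_zero_mode (u v w : V) (q : ℤ) :
    𝒱.mode u 0 (𝒱.mode v q w) = 𝒱.mode (𝒱.mode u 0 v) q w + 𝒱.mode v q (𝒱.mode u 0 w) := by
  have := 𝒱.commutator_natCast u v w 0 q
  simp at this
  exact sub_eq_iff_eq_add.1 this

theorem mode_one_mode (u v w : V) (q : ℤ) :
    𝒱.mode u 1 (𝒱.mode v q w) = 𝒱.mode (𝒱.mode u 0 v) (q + 1) w +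
      𝒱.mode (𝒱.mode u 1 v) q w + 𝒱.mode v q (𝒱.mode u 1 w) := by
  have := 𝒱.commutator_natCast u v w 1 q
  simp [Finset.sum_range_succ] at this
  rw [sub_eq_iff_eq_add.1 this, add_comm 1 q]

theorem mode_neg_two_vacuum (u : V) : 𝒱.mode u (-2) 𝒱.vacuum = 𝒱.mode 𝒱.conformal 0 u := by
  have h := 𝒱.translation u (-1)
  have h2 := 𝒱.mode_vacuum (𝒱.mode 𝒱.conformal 0 u) (-1) le_rfl
  rw [if_pos rfl, h] at h2
  simpa using h2

theorem mode_vacuum_of_nonneg (u : V) {n : ℤ} (hn : 0 ≤ n) : 𝒱.mode u n 𝒱.vacuum = 0 := by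
  rw [mode, 𝒱.mode_vacuum u n (by omega), if_neg (by omega)]

theorem mode_neg_one_vacuum (u : V) : 𝒱.mode u (-1) 𝒱.vacuum = u := by
  rw [mode, 𝒱.mode_vacuum u (-1) le_rfl, if_pos rfl]

/-- Skew-symmetry of the zeroth product, when the products of order at least two vanish. -/
theorem mode_zero_skew {u v : V} (h : ∀ i : ℕ, 2 ≤ i → 𝒱.mode u i v = 0) :
    𝒱.mode u 0 v - 𝒱.mode 𝒱.conformal 0 (𝒱.mode u 1 v) = -𝒱.mode v 0 u := by
  -- Apply `[u(-1), v(0)]` to the vacuum; only the terms `i = 0, 1` survive.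
  have := 𝒱.commutator_eq_sum h 𝒱.vacuum (-1) 0
  rw [𝒱.mode_vacuum_of_nonneg v le_rfl, map_zero, 𝒱.mode_neg_one_vacuum, zero_sub] at this
  rw [this, Finset.sum_range_succ, Finset.sum_range_one, ← 𝒱.mode_neg_two_vacuum]
  have h1 : (-1 + 0 - ((1 : ℕ) : ℤ)) = -2 := by norm_num
  have h0 : (-1 + 0 - ((0 : ℕ) : ℤ)) = -1 := by norm_num
  rw [h1, h0, 𝒱.mode_neg_one_vacuum]
  simp [sub_eq_add_neg]

theorem mode_translation_zero (t : V) : 𝒱.mode (𝒱.mode 𝒱.conformal 0 t) 0 = 0 := by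
  rw [mode, 𝒱.translation]
  simp

theorem translation_mode_zero (x z : V) :
    𝒱.mode 𝒱.conformal 0 (𝒱.mode x 0 z) = 𝒱.mode x 0 (𝒱.mode 𝒱.conformal 0 z) := by
  rw [mode_zero_mode, mode_translation_zero]
  simp

end Commutator

/-! ### Conformal weights. -/

section Weight

/-- Eigenspaces of `L(0)` are independent, so an eigenvector of eigenvalue `n` has no component
outside `V_n`. -/
theorem mem_weightSpace_iff {n : ℤ} {v : V} :
    v ∈ 𝒱.weightSpace n ↔ 𝒱.mode 𝒱.conformal 1 v = (n : ℂ) • v := by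
  refine ⟨𝒱.weight_eq n v, fun h => ?_⟩
  set E : ℤ → Submodule ℂ V := fun n => (𝒱.mode 𝒱.conformal 1).eigenspace (n : ℂ)
  have hE : iSupIndep E :=
    ((𝒱.mode 𝒱.conformal 1).eigenspaces_iSupIndep).comp Int.cast_injective
  have hle : ∀ m, 𝒱.weightSpace m ≤ E m := fun m w hw =>
    Module.End.mem_eigenspace_iff.2 (𝒱.weight_eq m w hw)
  have hv : v ∈ 𝒱.weightSpace n ⊔ ⨆ (m) (_ : m ≠ n), 𝒱.weightSpace m := by
    have : 𝒱.weightSpace n ⊔ ⨆ (m) (_ : m ≠ n), 𝒱.weightSpace m = ⊤ := by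
      rw [eq_top_iff, ← 𝒱.isInternal.submodule_iSup_eq_top]
      refine iSup_le fun m => ?_
      by_cases hm : m = n
      · rw [hm]; exact le_sup_left
      · exact (le_iSup₂ (f := fun m (_ : m ≠ n) => 𝒱.weightSpace m) m hm).trans le_sup_right
    rw [this]; trivial
  obtain ⟨a, ha, b, hb, rfl⟩ := Submodule.mem_sup.1 hv
  have hb1 : b ∈ E n := by
    have := (E n).sub_mem (Module.End.mem_eigenspace_iff.2 h) (hle n ha)
    simpa using this
  have hb2 : b ∈ ⨆ (m) (_ : m ≠ n), E m := (iSup₂_mono fun m _ => hle m) hb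
  have : b = 0 := Submodule.disjoint_def.1 (hE n) b hb1 hb2
  rwa [this, add_zero]

theorem mode_mem {k l : ℤ} {u v : V} (hu : u ∈ 𝒱.weightSpace k) (hv : v ∈ 𝒱.weightSpace l)
    (n : ℤ) : 𝒱.mode u n v ∈ 𝒱.weightSpace (k + l - n - 1) := by
  rw [mem_weightSpace_iff] at *
  rw [mode_one_mode, hu, hv]
  have := 𝒱.translation u (n + 1)
  rw [mode, this, add_sub_cancel_right, mode_smul, map_smul]
  simp only [LinearMap.smul_apply, ← add_smul]
  congr 1
  push_cast
  ring

theorem mode_mem' {k l m : ℤ} {u v : V} (hu : u ∈ 𝒱.weightSpace k) (hv : v ∈ 𝒱.weightSpace l)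
    (n : ℤ) (h : m = k + l - n - 1) : 𝒱.mode u n v ∈ 𝒱.weightSpace m :=
  h ▸ 𝒱.mode_mem hu hv n

theorem vacuum_mem : 𝒱.vacuum ∈ 𝒱.weightSpace 0 := by
  rw [mem_weightSpace_iff, mode_vacuum_of_nonneg _ _ zero_le_one]
  simp

theorem conformal_mem : 𝒱.conformal ∈ 𝒱.weightSpace 2 := by
  rw [mem_weightSpace_iff]
  -- `ω = L(-2)𝟏`, and `[L(0), L(-2)] = 2 L(-2)`.
  have h := LinearMap.congr_fun (𝒱.virasoro 0 (-2)) 𝒱.vacuum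
  have h1 := 𝒱.mode_vacuum_of_nonneg 𝒱.conformal zero_le_one
  have h2 := 𝒱.mode_neg_one_vacuum 𝒱.conformal
  simp only [mode] at h1 h2 ⊢
  norm_num [LieRing.of_associative_ring_bracket, h1, h2] at h
  rw [h]
  norm_num

end Weight

/-! ### The kernel of `L(-1)`. -/

section Simple

variable {𝒱}

theorem IsSimple.vacuum_ne_zero (h : 𝒱.IsSimple) : 𝒱.vacuum ≠ 0 := by
  have := h.1
  intro h0
  obtain ⟨v, hv⟩ := exists_ne (0 : V)
  apply hv
  have := 𝒱.mode_neg_one_vacuum v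
  rw [h0, map_zero] at this
  exact this.symm

/-- In a simple vertex operator algebra the kernel of `L(-1)` is spanned by the vacuum. -/
theorem IsSimple.exists_smul_vacuum (h : 𝒱.IsSimple) {v : V}
    (hv : 𝒱.mode 𝒱.conformal 0 v = 0) : ∃ c : ℂ, v = c • 𝒱.vacuum := by
  have := h.1
  -- The translation axiom at index `n + 1` reads `0 = -(n + 1) v(n)`.
  have hvn : ∀ n : ℤ, n ≠ -1 → 𝒱.mode v n = 0 := by
    intro n hn
    have := 𝒱.translation v (n + 1)
    rw [show vertexMode 𝒱.Y 0 𝒱.conformal v = 0 from hv, map_zero, add_sub_cancel_right] at this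
    have hn' : (-((n + 1 : ℤ) : ℂ)) ≠ 0 := by
      rw [neg_ne_zero, Int.cast_ne_zero]; omega
    exact (smul_eq_zero.1 this.symm).resolve_left hn'
  -- All `v(i)` with `i ≥ 0` vanish, so `v(-1)` commutes with every mode. By Schur's lemma, with an
  -- eigenvalue from a nonzero `V_n`, it is a scalar, which is read off on the vacuum.
  have hcomm : ∀ (u : V) (q : ℤ) (w : V),
      𝒱.mode v (-1) (𝒱.mode u q w) = 𝒱.mode u q (𝒱.mode v (-1) w) := by
    intro u q w
    have := 𝒱.commutator_eq_sum (u := v) (v := u) (k := 0)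
      (fun i _ => by rw [hvn i (by omega)]; rfl) w (-1) q
    exact sub_eq_zero.1 this
  obtain ⟨n, hn⟩ : ∃ n, 𝒱.weightSpace n ≠ ⊥ := by
    by_contra hcon
    push Not at hcon
    have := 𝒱.isInternal.submodule_iSup_eq_top
    rw [iSup_congr hcon, iSup_bot] at this
    exact bot_ne_top this
  have hfd := 𝒱.finiteDimensional n
  have hnt : Nontrivial (𝒱.weightSpace n) := Submodule.nontrivial_iff_ne_bot.2 hn
  have hpres : ∀ w ∈ 𝒱.weightSpace n, 𝒱.mode v (-1) w ∈ 𝒱.weightSpace n := by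
    intro w hw
    rw [mem_weightSpace_iff] at *
    rw [← hcomm, hw, map_smul]
  obtain ⟨c, hc⟩ := Module.End.exists_eigenvalue ((𝒱.mode v (-1)).restrict hpres)
  obtain ⟨w, hw, hw0⟩ := hc.exists_hasEigenvector
  rw [Module.End.mem_eigenspace_iff] at hw
  have hwc : 𝒱.mode v (-1) w = c • (w : V) := congrArg Subtype.val hw
  have htop : LinearMap.ker (𝒱.mode v (-1) - c • LinearMap.id) = ⊤ := by
    refine (h.2 _ ?_).resolve_left ?_
    · intro u n x hx
      simp only [LinearMap.mem_ker, LinearMap.sub_apply, LinearMap.smul_apply, LinearMap.id_apply,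
        sub_eq_zero] at hx ⊢
      rw [hcomm, hx, map_smul]
    · intro hbot
      have : (w : V) ∈ LinearMap.ker (𝒱.mode v (-1) - c • LinearMap.id) := by
        simp [hwc]
      rw [hbot, Submodule.mem_bot] at this
      exact hw0 (Subtype.ext this)
  refine ⟨c, ?_⟩
  have : 𝒱.vacuum ∈ LinearMap.ker (𝒱.mode v (-1) - c • LinearMap.id) := by rw [htop]; trivial
  rw [LinearMap.mem_ker, LinearMap.sub_apply, mode_neg_one_vacuum, sub_eq_zero] at this
  exact this

end Simple

end VertexOperatorAlgebra

namespace VertexOperatorAlgebra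

variable {V : Type*} [AddCommGroup V] [Module ℂ V] {𝒱 : VertexOperatorAlgebra V}

/-! ### Perfect subalgebras of `F` and the affine relations. -/

section PerfectSubalgebra

variable {S : Submodule ℂ V}

theorem eq_zero_of_perfect (hp : Submodule.map₂ 𝒱.bracket S S = S) {M : Type*} [AddCommGroup M]
    [Module ℂ M] (f : V →ₗ[ℂ] M) (h : ∀ u ∈ S, ∀ v ∈ S, f (𝒱.mode u 0 v) = 0) :
    ∀ x ∈ S, f x = 0 := by
  have : Submodule.map₂ 𝒱.bracket S S ≤ LinearMap.ker f := Submodule.map₂_le.2 h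
  rw [hp] at this
  exact this

/-- The zeroth mode of `[uv]` is the commutator of `u(0)` and `v(0)`. -/
theorem mode_zero_eq_zero_of_perfect (hp : Submodule.map₂ 𝒱.bracket S S = S) {z : V}
    (h : ∀ u ∈ S, ∀ v ∈ S, 𝒱.mode u 0 (𝒱.mode v 0 z) = 0) : ∀ x ∈ S, 𝒱.mode x 0 z = 0 := by
  refine eq_zero_of_perfect hp ((vertexMode 𝒱.Y 0).flip z) fun u hu v hv => ?_
  have := 𝒱.mode_zero_mode u v z 0
  rw [h u hu v hv, h v hv u hu, add_zero] at this
  exact this.symm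

/-- Zeroth modes commute with `L(-1)`, so `v(0)z` is a multiple of the vacuum, which `u(0)` kills.
-/
theorem mode_zero_eq_zero_of_translation (hsimple : 𝒱.IsSimple)
    (hp : Submodule.map₂ 𝒱.bracket S S = S) {z : V}
    (h : ∀ x ∈ S, 𝒱.mode x 0 (𝒱.mode 𝒱.conformal 0 z) = 0) : ∀ x ∈ S, 𝒱.mode x 0 z = 0 := by
  refine mode_zero_eq_zero_of_perfect hp fun u _ v hv => ?_
  obtain ⟨c, hc⟩ := hsimple.exists_smul_vacuum (v := 𝒱.mode v 0 z)
    (by rw [translation_mode_zero, h v hv])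
  rw [hc, map_smul, 𝒱.mode_vacuum_of_nonneg u le_rfl, smul_zero]

theorem bracket_add_bracket_mem_leibnizKernel {u a : V} (hu : u ∈ 𝒱.weightSpace 1)
    (ha : a ∈ 𝒱.weightSpace 1) : 𝒱.bracket u a + 𝒱.bracket a u ∈ 𝒱.leibnizKernel := by
  have h : ∀ b ∈ 𝒱.weightSpace 1, 𝒱.bracket b b ∈ 𝒱.leibnizKernel := fun b hb =>
    Submodule.subset_span ⟨b, hb, rfl⟩
  have h2 : 𝒱.bracket u a + 𝒱.bracket a u =
      𝒱.bracket (u + a) (u + a) - 𝒱.bracket u u - 𝒱.bracket a a := by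
    simp only [map_add, LinearMap.add_apply]
    abel
  rw [h2]
  exact Submodule.sub_mem _ (Submodule.sub_mem _ (h _ (Submodule.add_mem _ hu ha)) (h u hu)) (h a ha)

variable (hsimple : 𝒱.IsSimple) (hF : S ≤ 𝒱.kernelAnnihilator)
  (hp : Submodule.map₂ 𝒱.bracket S S = S)

include hsimple hF hp

theorem mode_zero_eq_zero_of_weight_nonpos {k : ℤ} (hk : k ≤ 0) {z : V}
    (hz : z ∈ 𝒱.weightSpace k) : ∀ x ∈ S, 𝒱.mode x 0 z = 0 := by
  obtain ⟨n, rfl⟩ : ∃ n : ℕ, k = -n := ⟨k.natAbs, by omega⟩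
  induction n generalizing z with
  | zero =>
    refine mode_zero_eq_zero_of_translation hsimple hp (mode_zero_eq_zero_of_perfect hp
      fun u hu v hv => ?_)
    set a := 𝒱.mode 𝒱.conformal 0 z
    have ha : a ∈ 𝒱.weightSpace 1 := 𝒱.mode_mem' 𝒱.conformal_mem hz 0 (by norm_num)
    -- `a = L(-1)z` has `a(0) = 0`, so `v(0)a` alone lies in `N`, where `u ∈ F` acts as zero.
    have hN := bracket_add_bracket_mem_leibnizKernel (hF hv).1 ha
    have h0 : 𝒱.bracket a v = 0 := LinearMap.congr_fun (𝒱.mode_translation_zero z) v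
    rw [h0, add_zero] at hN
    exact (hF hu).2 _ hN
  | succ n ih =>
    refine mode_zero_eq_zero_of_translation hsimple hp (ih ?_ ?_)
    · omega
    · exact 𝒱.mode_mem' 𝒱.conformal_mem hz 0 (by push_cast; ring)

/-- For `x = [uv]`, `x(n)` is the commutator of `u(0)` and `v(n)`; since `v(n)z` has weight `k - n ≤
0`, the case of zeroth modes applies twice. -/
theorem mode_eq_zero_of_weight_nonpos {k : ℤ} (hk : k ≤ 0) {z : V}
    (hz : z ∈ 𝒱.weightSpace k) {x : V} (hx : x ∈ S) {n : ℤ} (hn : 0 ≤ n) :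
    𝒱.mode x n z = 0 := by
  obtain rfl | hn := hn.eq_or_lt
  · exact mode_zero_eq_zero_of_weight_nonpos hsimple hF hp hk hz x hx
  refine eq_zero_of_perfect hp ((vertexMode 𝒱.Y n).flip z) (fun u hu v hv => ?_) x hx
  have h := 𝒱.mode_zero_mode u v z n
  rw [mode_zero_eq_zero_of_weight_nonpos hsimple hF hp hk hz u hu, map_zero, add_zero,
    mode_zero_eq_zero_of_weight_nonpos hsimple hF hp (k := k - n) (by omega)
      (𝒱.mode_mem' (hF hv).1 hz n (by ring)) u hu] at h
  exact h.symm

/-- All `x(i)z` with `i ≥ 0` vanish, so `x(-1)` and `z(n)` commute; apply both orders to the vacuum.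
-/
theorem mode_of_weight_nonpos_eq_zero {k : ℤ} (hk : k ≤ 0) {z : V}
    (hz : z ∈ 𝒱.weightSpace k) {x : V} (hx : x ∈ S) {n : ℤ} (hn : 0 ≤ n) :
    𝒱.mode z n x = 0 := by
  have h := 𝒱.commutator_eq_sum (u := x) (v := z) (k := 0)
    (fun i _ => mode_eq_zero_of_weight_nonpos hsimple hF hp hk hz hx (by omega)) 𝒱.vacuum (-1) n
  rw [𝒱.mode_vacuum_of_nonneg z hn, map_zero, 𝒱.mode_neg_one_vacuum, Finset.sum_range_zero,
    zero_sub, neg_eq_zero] at h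
  exact h

/-- For `x = [uv]`, expand `[u(1), v(k - 1)]w`: every term except `x(k)w` involves a vector of
weight `0` or `2 - k`, and vanishes. -/
theorem mode_eq_zero_of_two_le {x w : V} (hx : x ∈ S) (hw : w ∈ S) {k : ℤ} (hk : 2 ≤ k) :
    𝒱.mode x k w = 0 := by
  refine eq_zero_of_perfect hp ((vertexMode 𝒱.Y k).flip w) (fun u hu v hv => ?_) x hx
  have h := 𝒱.mode_one_mode u v w (k - 1)
  rw [mode_eq_zero_of_weight_nonpos hsimple hF hp (k := 2 - k) (by omega)
      (𝒱.mode_mem' (hF hv).1 (hF hw).1 (k - 1) (by ring)) hu zero_le_one,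
    mode_eq_zero_of_weight_nonpos hsimple hF hp le_rfl
      (𝒱.mode_mem' (hF hu).1 (hF hw).1 1 (by ring)) hv (by omega),
    mode_of_weight_nonpos_eq_zero hsimple hF hp le_rfl
      (𝒱.mode_mem' (hF hu).1 (hF hv).1 1 (by ring)) hw (by omega),
    add_zero, add_zero, sub_add_cancel] at h
  exact h.symm

/-- Skew-symmetry reads `u(0)v - L(-1)u(1)v = -v(0)u`; as the bracket alternates on `S`, `L(-1)u(1)v
= 0`. -/
theorem exists_mode_one_eq_smul_vacuum (halt : ∀ a ∈ S, 𝒱.bracket a a = 0) {u v : V} (hu : u ∈ S)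
    (hv : v ∈ S) : ∃ c : ℂ, 𝒱.mode u 1 v = c • 𝒱.vacuum := by
  refine hsimple.exists_smul_vacuum ?_
  have h := 𝒱.mode_zero_skew (u := u) (v := v) fun i hi =>
    mode_eq_zero_of_two_le hsimple hF hp hu hv (by omega)
  have h2 : 𝒱.mode u 0 v + 𝒱.mode v 0 u = 0 := by
    have h3 : 𝒱.bracket u v + 𝒱.bracket v u = 0 := by
      simpa [halt u hu, halt v hv] using halt (u + v) (S.add_mem hu hv)
    exact h3
  rw [eq_neg_of_add_eq_zero_left h2, sub_eq_self] at h
  exact h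

/-- The fields of a perfect Lie subalgebra of `F` close on an affine algebra. -/
theorem exists_affine_form (halt : ∀ a ∈ S, 𝒱.bracket a a = 0) :
    ∃ α : LinearMap.BilinForm ℂ S, ∀ u v : S,
      𝒱.mode u 1 v = α u v • 𝒱.vacuum ∧
      ∀ m n : ℤ, ⁅𝒱.mode u m, 𝒱.mode v n⁆ =
        𝒱.mode (𝒱.mode u 0 v) (m + n) +
          (if m + n = 0 then (m : ℂ) * α u v else 0) • LinearMap.id := by
  obtain ⟨f, hf⟩ : ∃ f : Module.Dual ℂ V, f 𝒱.vacuum = 1 := by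
    obtain ⟨f, hf⟩ := not_forall.1
      (mt (Module.forall_dual_apply_eq_zero_iff ℂ 𝒱.vacuum).1 hsimple.vacuum_ne_zero)
    exact ⟨(f 𝒱.vacuum)⁻¹ • f, by simp [hf]⟩
  let α : LinearMap.BilinForm ℂ S :=
    ((vertexMode 𝒱.Y 1).compr₂ f).compl₁₂ S.subtype S.subtype
  have hα : ∀ u v : S, 𝒱.mode u 1 v = α u v • 𝒱.vacuum := by
    intro u v
    obtain ⟨c, hc⟩ := exists_mode_one_eq_smul_vacuum hsimple hF hp halt u.2 v.2
    have : α u v = f (𝒱.mode u 1 v) := rfl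
    rw [this, hc, map_smul, hf, smul_eq_mul, mul_one]
  refine ⟨α, fun u v => ⟨hα u v, fun m n => ?_⟩⟩
  ext w
  have h := 𝒱.commutator_eq_sum (u := u) (v := v) (k := 2)
    (fun i hi => mode_eq_zero_of_two_le hsimple hF hp u.2 v.2 (by omega)) w m n
  rw [LieRing.of_associative_ring_bracket, LinearMap.sub_apply, Module.End.mul_apply,
    Module.End.mul_apply, h, Finset.sum_range_succ, Finset.sum_range_one]
  have hvac : 𝒱.mode 𝒱.vacuum (m + n - 1) = _ := 𝒱.vacuum_mode _
  simp only [Nat.cast_one, Nat.cast_zero, hα u v, mode_smul, Ring.choose_zero_right,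
    Ring.choose_one_right, sub_zero]
  rw [hvac]
  by_cases hmn : m + n = 0
  · simp [hmn, mul_smul]
  · have : m + n - 1 ≠ -1 := by omega
    simp [hmn, this]

end PerfectSubalgebra

/-! ### Primary vectors. -/

section Primary

variable {S : Submodule ℂ V}

/-- In `[ω(m), s(0)]` the terms `i = 0` and `i = 1` are `-m s(m - 1)` and `m s(m - 1)`, because `s`
has weight one. -/
theorem conformal_mode_bracket {s b : V} {m : ℕ} (hm : 1 ≤ m) (hs : s ∈ 𝒱.weightSpace 1)
    (h : ∀ i : ℕ, 2 ≤ i → i ≤ m → 𝒱.mode (𝒱.mode 𝒱.conformal i s) ((m - i : ℕ) : ℤ) b = 0) :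
    𝒱.mode 𝒱.conformal m (𝒱.mode s 0 b) = 𝒱.mode s 0 (𝒱.mode 𝒱.conformal m b) := by
  have h1 := 𝒱.commutator_natCast 𝒱.conformal s b m 0
  obtain ⟨k, rfl⟩ : ∃ k, m = k + 1 := ⟨m - 1, by omega⟩
  rw [Finset.sum_range_succ', Finset.sum_range_succ', Finset.sum_eq_zero] at h1
  · rw [← sub_eq_zero, h1, zero_add, zero_add]
    have ht := 𝒱.translation s ((k + 1 : ℕ) : ℤ)
    have hw := 𝒱.mem_weightSpace_iff.1 hs
    simp only [Nat.cast_zero, Nat.cast_one, Nat.choose_zero_right, Nat.choose_one_right,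
      sub_zero, add_zero, mode] at ht hw ⊢
    rw [ht, hw]
    simp only [Nat.cast_add, Nat.cast_one, Int.cast_add, Int.cast_natCast, Int.cast_one, one_smul,
      add_sub_cancel_right, LinearMap.smul_apply, ← add_smul]
    simp
  · intro i hi
    have hi := Finset.mem_range.1 hi
    have := h (i + 2) (by omega) (by omega)
    rw [Nat.cast_sub (by omega)] at this
    simp only [add_zero, add_assoc, Nat.reduceAdd] at this ⊢
    rw [this, smul_zero]

variable (hsimple : 𝒱.IsSimple) (hF : S ≤ 𝒱.kernelAnnihilator)
  (hp : Submodule.map₂ 𝒱.bracket S S = S)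

include hsimple hF hp

/-- For `x = u(0)v`, `ω(m)` moves past `u(0)`, and `ω(m)v` has weight `2 - m ≤ 0`, so `u(0)` kills
it. -/
theorem conformal_mode_eq_zero_of_mem {x : V} (hx : x ∈ S) {m : ℕ} (hm : 2 ≤ m) :
    𝒱.mode 𝒱.conformal m x = 0 := by
  refine eq_zero_of_perfect hp (𝒱.mode 𝒱.conformal m) (fun u hu v hv => ?_) x hx
  rw [conformal_mode_bracket (by omega) (hF hu).1]
  · exact mode_eq_zero_of_weight_nonpos hsimple hF hp (k := 2 - m) (by omega)
      (𝒱.mode_mem' 𝒱.conformal_mem (hF hv).1 m (by ring)) hu le_rfl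
  · intro i hi _
    exact mode_of_weight_nonpos_eq_zero hsimple hF hp (k := 2 - i) (by omega)
      (𝒱.mode_mem' 𝒱.conformal_mem (hF hu).1 i (by ring)) hv (by omega)

/-- The elements of `[S, V₁]` are primary. -/
theorem conformal_mode_eq_zero_of_mem_map₂ {a : V}
    (ha : a ∈ Submodule.map₂ 𝒱.bracket S (𝒱.weightSpace 1)) {m : ℕ} (hm : 2 ≤ m) :
    𝒱.mode 𝒱.conformal m a = 0 := by
  suffices Submodule.map₂ 𝒱.bracket S (𝒱.weightSpace 1) ≤ LinearMap.ker (𝒱.mode 𝒱.conformal m)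
    from this ha
  refine Submodule.map₂_le.2 fun s hs b hb => ?_
  rw [LinearMap.mem_ker]
  refine (conformal_mode_bracket (𝒱 := 𝒱) (by omega) (hF hs).1 fun i hi _ => ?_).trans ?_
  · rw [conformal_mode_eq_zero_of_mem hsimple hF hp hs hi, mode_zero, LinearMap.zero_apply]
  · exact mode_eq_zero_of_weight_nonpos hsimple hF hp (k := 2 - m) (by omega)
      (𝒱.mode_mem' 𝒱.conformal_mem hb m (by ring)) hs le_rfl

/-- For primary `a` of weight one, skew-symmetry gives `-a(0)ω = L(-1)a - L(-1)L(0)a = 0`. -/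
theorem mode_zero_conformal_of_mem_map₂ {a : V}
    (ha : a ∈ Submodule.map₂ 𝒱.bracket S (𝒱.weightSpace 1)) (ha1 : a ∈ 𝒱.weightSpace 1) :
    𝒱.mode a 0 𝒱.conformal = 0 := by
  have h := 𝒱.mode_zero_skew (u := 𝒱.conformal) (v := a) fun i hi =>
    conformal_mode_eq_zero_of_mem_map₂ hsimple hF hp ha hi
  rw [𝒱.mem_weightSpace_iff.1 ha1, Int.cast_one, one_smul, sub_self] at h
  exact neg_eq_zero.1 h.symm

end Primary

/-! ### Exponentials as automorphisms. -/

section Aut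

variable (𝒱)

/-- The exponential of `a(0)` for `a` of weight one. -/
noncomputable def expMode (a : V) (ha : a ∈ 𝒱.weightSpace 1) : V ≃ₗ[ℂ] V :=
  haveI := 𝒱.finiteDimensional
  LinearMap.gradedExp 𝒱.isInternal (𝒱.mode a 0)
    fun _ _ hv => 𝒱.mode_mem' ha hv 0 (by ring)

variable {𝒱}

theorem expMode_apply_sub_mem {a : V} (ha : a ∈ 𝒱.weightSpace 1) {k : ℤ} {J : Submodule ℂ V}
    (hJ : ∀ x ∈ J, 𝒱.mode a 0 x ∈ J) {w : V} (hw : w ∈ 𝒱.weightSpace k)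
    (h : 𝒱.mode a 0 (𝒱.mode a 0 w) ∈ J) :
    𝒱.expMode a ha w - (w + 𝒱.mode a 0 w) ∈ J := by
  have := 𝒱.finiteDimensional
  have hD : ∀ i, ∀ v ∈ 𝒱.weightSpace i, 𝒱.mode a 0 v ∈ 𝒱.weightSpace i :=
    fun i v hv => 𝒱.mode_mem' ha hv 0 (by ring)
  have key := LinearMap.finExp_sub_mem (T := (𝒱.mode a 0).restrict (hD k))
    (J := J.comap (𝒱.weightSpace k).subtype) (fun x hx => hJ x hx) (w := ⟨w, hw⟩) h
  have h2 := LinearMap.gradedExp_apply 𝒱.isInternal (𝒱.mode a 0) hD k ⟨w, hw⟩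
  rw [expMode, h2]
  exact key

theorem expMode_apply_eq_self {a : V} (ha : a ∈ 𝒱.weightSpace 1) {k : ℤ} {w : V}
    (hw : w ∈ 𝒱.weightSpace k) (h : 𝒱.mode a 0 w = 0) : 𝒱.expMode a ha w = w := by
  have := expMode_apply_sub_mem ha (J := ⊥) (by simp) hw (by simp [h])
  rwa [h, add_zero, Submodule.mem_bot, sub_eq_zero] at this

theorem expMode_mode {a : V} (ha : a ∈ 𝒱.weightSpace 1) (u v : V) (n : ℤ) :
    𝒱.expMode a ha (𝒱.mode u n v) = 𝒱.mode (𝒱.expMode a ha u) n (𝒱.expMode a ha v) := by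
  have := 𝒱.finiteDimensional
  have hD : ∀ i, ∀ v ∈ 𝒱.weightSpace i, 𝒱.mode a 0 v ∈ 𝒱.weightSpace i :=
    fun i v hv => 𝒱.mode_mem' ha hv 0 (by ring)
  have hg : ∀ i (v : 𝒱.weightSpace i), 𝒱.expMode a ha v =
      LinearMap.finExp ((𝒱.mode a 0).restrict (hD i)) v := fun i v =>
    LinearMap.gradedExp_apply 𝒱.isInternal (𝒱.mode a 0) hD i v
  let g : V →ₗ[ℂ] V := 𝒱.expMode a ha
  suffices (vertexMode 𝒱.Y n).compr₂ g = (vertexMode 𝒱.Y n).compl₁₂ g g from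
    LinearMap.congr_fun₂ this u v
  -- On homogeneous vectors the product is a bilinear map of finite-dimensional spaces, for which
  -- `a(0)` is a derivation.
  refine LinearMap.ext_of_isInternal 𝒱.isInternal fun k u hu =>
    LinearMap.ext_of_isInternal 𝒱.isInternal fun l v hv => ?_
  let B : 𝒱.weightSpace k →ₗ[ℂ] 𝒱.weightSpace l →ₗ[ℂ] 𝒱.weightSpace (k + l - n - 1) :=
    LinearMap.mk₂ ℂ (fun u v => ⟨𝒱.mode u n v, 𝒱.mode_mem u.2 v.2 n⟩)
      (fun u u' v => Subtype.ext (by simp)) (fun c u v => Subtype.ext (by simp))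
      (fun u v v' => Subtype.ext (by simp)) (fun c u v => Subtype.ext (by simp))
  have key := LinearMap.finExp_bilin (T₁ := (𝒱.mode a 0).restrict (hD k))
    (T₂ := (𝒱.mode a 0).restrict (hD l)) (T₃ := (𝒱.mode a 0).restrict (hD (k + l - n - 1))) B
    (fun u v => Subtype.ext (𝒱.mode_zero_mode a u v n)) ⟨u, hu⟩ ⟨v, hv⟩
  change 𝒱.expMode a ha (𝒱.mode u n v) = 𝒱.mode (𝒱.expMode a ha u) n (𝒱.expMode a ha v)
  have h1 := hg _ (B ⟨u, hu⟩ ⟨v, hv⟩)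
  rw [key] at h1
  rw [hg k ⟨u, hu⟩, hg l ⟨v, hv⟩]
  exact h1

theorem expMode_mem_aut {a : V} (ha : a ∈ 𝒱.weightSpace 1) (hω : 𝒱.mode a 0 𝒱.conformal = 0) :
    𝒱.expMode a ha ∈ 𝒱.aut :=
  ⟨expMode_apply_eq_self ha 𝒱.vacuum_mem (𝒱.mode_vacuum_of_nonneg a le_rfl),
    expMode_apply_eq_self ha 𝒱.conformal_mem hω, expMode_mode ha⟩

end Aut

end VertexOperatorAlgebra

namespace VertexOperatorAlgebra

variable {V : Type*} [AddCommGroup V] [Module ℂ V] {𝒱 : VertexOperatorAlgebra V}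

/-! ### The Leibniz kernel. -/

section LeibnizKernel

theorem leibnizKernel_le_weightSpace_one : 𝒱.leibnizKernel ≤ 𝒱.weightSpace 1 := by
  refine Submodule.span_le.2 ?_
  rintro _ ⟨a, ha, rfl⟩
  exact 𝒱.mode_mem' ha ha 0 (by norm_num)

/-- The term `[a[ac]]` stands on both sides of the Leibniz identity for `a, a, c`, leaving `[[aa]c]
= 0`. -/
theorem bracket_eq_zero_of_mem_leibnizKernel {x : V} (hx : x ∈ 𝒱.leibnizKernel) (c : V) :
    𝒱.bracket x c = 0 := by
  suffices 𝒱.leibnizKernel ≤ LinearMap.ker (𝒱.bracket.flip c) from this hx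
  refine Submodule.span_le.2 ?_
  rintro _ ⟨a, -, rfl⟩
  have := 𝒱.isLeftLeibniz_bracket a a c
  exact right_eq_add.1 this

theorem leibnizKernel_le_kernelAnnihilator : 𝒱.leibnizKernel ≤ 𝒱.kernelAnnihilator :=
  fun _ hx => ⟨leibnizKernel_le_weightSpace_one hx,
    fun _ _ => bracket_eq_zero_of_mem_leibnizKernel hx _⟩

theorem kernelAnnihilator_le_weightSpace_one : 𝒱.kernelAnnihilator ≤ 𝒱.weightSpace 1 :=
  fun _ h => h.1

instance : FiniteDimensional ℂ 𝒱.kernelAnnihilator :=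
  have := 𝒱.finiteDimensional 1
  Submodule.finiteDimensional_of_le kernelAnnihilator_le_weightSpace_one

theorem isIdealOf_leibnizKernel :
    LeibnizAlg.IsIdealOf 𝒱.bracket 𝒱.kernelAnnihilator 𝒱.leibnizKernel :=
  ⟨leibnizKernel_le_kernelAnnihilator, fun a ha x hx => by
    rw [ha.2 x hx, bracket_eq_zero_of_mem_leibnizKernel hx]
    exact ⟨Submodule.zero_mem _, Submodule.zero_mem _⟩⟩

theorem isSolvable_leibnizKernel : LeibnizAlg.IsSolvable 𝒱.bracket 𝒱.leibnizKernel :=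
  ⟨1, le_bot_iff.1 <| Submodule.map₂_le.2 fun _ hx _ _ =>
    (Submodule.mem_bot ℂ).2 (bracket_eq_zero_of_mem_leibnizKernel hx _)⟩

end LeibnizKernel

section Aut

variable {g : V ≃ₗ[ℂ] V}

theorem map_mem_weightSpace (hg : g ∈ 𝒱.aut) {n : ℤ} {v : V} (hv : v ∈ 𝒱.weightSpace n) :
    g v ∈ 𝒱.weightSpace n := by
  rw [mem_weightSpace_iff] at *
  have := hg.2.2 𝒱.conformal v 1
  rw [hg.2.1, hv, map_smul] at this
  exact this.symm

theorem map_mem_leibnizKernel (hg : g ∈ 𝒱.aut) {x : V} (hx : x ∈ 𝒱.leibnizKernel) :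
    g x ∈ 𝒱.leibnizKernel := by
  suffices 𝒱.leibnizKernel ≤ 𝒱.leibnizKernel.comap (g : V →ₗ[ℂ] V) from this hx
  refine Submodule.span_le.2 ?_
  rintro _ ⟨a, ha, rfl⟩
  exact Submodule.subset_span ⟨g a, map_mem_weightSpace hg ha, hg.2.2 a a 0⟩

theorem map_kernelAnnihilator_le (hg : g ∈ 𝒱.aut) :
    𝒱.kernelAnnihilator.map (g : V →ₗ[ℂ] V) ≤ 𝒱.kernelAnnihilator := by
  rintro _ ⟨a, ha, rfl⟩
  refine ⟨map_mem_weightSpace hg ha.1, fun x hx => ?_⟩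
  have hx' := map_mem_leibnizKernel (𝒱.aut.inv_mem hg) hx
  have h2 := hg.2.2 a ((g⁻¹ : V ≃ₗ[ℂ] V) x) 0
  have h3 : g ((g⁻¹ : V ≃ₗ[ℂ] V) x) = x := g.apply_symm_apply x
  rw [h3] at h2
  refine h2.symm.trans ?_
  rw [show 𝒱.mode a 0 ((g⁻¹ : V ≃ₗ[ℂ] V) x) = 0 from ha.2 _ hx', map_zero]

theorem map_kernelAnnihilator (hg : g ∈ 𝒱.aut) :
    𝒱.kernelAnnihilator.map (g : V →ₗ[ℂ] V) = 𝒱.kernelAnnihilator := by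
  refine le_antisymm (map_kernelAnnihilator_le hg) fun a ha => ?_
  exact ⟨_, map_kernelAnnihilator_le (𝒱.aut.inv_mem hg) ⟨a, ha, rfl⟩, g.apply_symm_apply a⟩

theorem IsLevi.map {S : Submodule ℂ V} (hS : 𝒱.IsLevi S) (hg : g ∈ 𝒱.aut) :
    𝒱.IsLevi (S.map (g : V →ₗ[ℂ] V)) := by
  have : FiniteDimensional ℂ S :=
    Submodule.finiteDimensional_of_le (LeibnizAlg.IsLeviSubalgebra.le hS)
  have h := LeibnizAlg.IsLeviSubalgebra.map g (fun a b => hg.2.2 a b 0) hS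
  rwa [map_kernelAnnihilator hg] at h

end Aut

/-! ### Conjugacy of Levi subalgebras. -/

section Conjugacy

variable {S₁ S₂ : Submodule ℂ V}

theorem IsLevi.exists_map_le_sup (hsimple : 𝒱.IsSimple) (h₁ : 𝒱.IsLevi S₁) (h₂ : 𝒱.IsLevi S₂)
    (k : ℕ) : ∃ g ∈ 𝒱.aut, S₁.map (g : V →ₗ[ℂ] V) ≤ S₂ ⊔
      (LeibnizAlg.derivedSeries 𝒱.bracket
        (LeibnizAlg.solvableRadical 𝒱.bracket 𝒱.kernelAnnihilator) k ⊔ 𝒱.leibnizKernel) := by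
  set B := LeibnizAlg.solvableRadical 𝒱.bracket 𝒱.kernelAnnihilator
  have hB : LeibnizAlg.IsIdealOf 𝒱.bracket 𝒱.kernelAnnihilator B :=
    LeibnizAlg.isIdealOf_solvableRadical
  have hNB : 𝒱.leibnizKernel ≤ B :=
    LeibnizAlg.le_solvableRadical isIdealOf_leibnizKernel isSolvable_leibnizKernel
  have hid : ∀ k, LeibnizAlg.IsIdealOf 𝒱.bracket 𝒱.kernelAnnihilator
      (LeibnizAlg.derivedSeries 𝒱.bracket B k ⊔ 𝒱.leibnizKernel) := fun k =>
    (hB.derivedSeries 𝒱.isLeftLeibniz_bracket k).sup isIdealOf_leibnizKernel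
  have hDB : ∀ k, LeibnizAlg.derivedSeries 𝒱.bracket B k ≤ B := by
    intro k
    induction k with
    | zero => exact le_rfl
    | succ k ih => exact Submodule.map₂_le.2 fun x hx y hy => (hB.2 x (hB.1 (ih hx)) y (ih hy)).1
  induction k with
  | zero =>
    refine ⟨1, 𝒱.aut.one_mem, ?_⟩
    rintro _ ⟨s, hs, rfl⟩
    have hsF := LeibnizAlg.IsLeviSubalgebra.le h₁ hs
    rw [← h₂.sup_eq] at hsF
    exact sup_le_sup_left (le_sup_left (a := B)) S₂ hsF
  | succ k ih =>
    obtain ⟨g, hg, hle⟩ := ih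
    have h₁' := h₁.map hg
    set S := S₁.map (g : V →ₗ[ℂ] V)
    set I := LeibnizAlg.derivedSeries 𝒱.bracket B k ⊔ 𝒱.leibnizKernel
    set J := LeibnizAlg.derivedSeries 𝒱.bracket B (k + 1) ⊔ 𝒱.leibnizKernel
    have hSF : S ≤ 𝒱.kernelAnnihilator := LeibnizAlg.IsLeviSubalgebra.le h₁'
    -- A map₂ of a space with itself is the first step of its derived series, hence `k := 1`.
    have hII : Submodule.map₂ 𝒱.bracket I I ≤ J := LeibnizAlg.derivedSeries_sup_le (k := 1)
      (hB.derivedSeries 𝒱.isLeftLeibniz_bracket k) isIdealOf_leibnizKernel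
    obtain ⟨a, ha, had⟩ := LeibnizAlg.IsLeviSubalgebra.exists_ad_mod h₁' h₂ (I := I) (J := J)
      (fun a ha b hb => le_sup_right (a := LeibnizAlg.derivedSeries 𝒱.bracket B (k + 1))
        (bracket_add_bracket_mem_leibnizKernel ha.1 hb.1)) (hid k) (hid (k + 1)) hII
      (sup_le (hDB k) hNB) hle
    have haI : a ∈ I :=
      (Submodule.map₂_le.2 fun s hs x hx => ((hid k).2 s (hSF hs) x hx).1 :
        Submodule.map₂ 𝒱.bracket S I ≤ I) ha
    have haF := (hid k).1 haI
    have haω := mode_zero_conformal_of_mem_map₂ hsimple hSF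
      (LeibnizAlg.IsLeviSubalgebra.map₂_self h₁')
      (Submodule.map₂_le_map₂_right
        ((hid k).1.trans kernelAnnihilator_le_weightSpace_one) ha) haF.1
    refine ⟨𝒱.expMode a haF.1 * g, 𝒱.aut.mul_mem (expMode_mem_aut haF.1 haω) hg, ?_⟩
    rintro _ ⟨s, hs, rfl⟩
    have hgs : g s ∈ S := ⟨s, hs, rfl⟩
    -- `a(0)a(0)(g s)` lies in `[I, I] ≤ J`, so modulo `J` the exponential acts as `1 + a(0)`.
    have h3 := expMode_apply_sub_mem haF.1 (J := J) (fun x hx => ((hid (k + 1)).2 a haF x hx).1)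
      (hSF hgs).1 (hII (Submodule.apply_mem_map₂ 𝒱.bracket haI ((hid k).2 _ (hSF hgs) a haI).2))
    have h4 := Submodule.add_mem _ (Submodule.mem_sup_right (S := S₂) h3) (had _ hgs)
    change 𝒱.expMode a haF.1 (g s) ∈ S₂ ⊔ J
    have h5 : 𝒱.expMode a haF.1 (g s) = 𝒱.expMode a haF.1 (g s) - (g s + 𝒱.mode a 0 (g s)) +
        (g s + 𝒱.bracket a (g s)) := (sub_add_cancel _ _).symm
    rw [h5]
    exact h4

theorem IsLevi.exists_map_eq (hsimple : 𝒱.IsSimple) (h₁ : 𝒱.IsLevi S₁) (h₂ : 𝒱.IsLevi S₂) :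
    ∃ g ∈ 𝒱.aut, S₁.map (g : V →ₗ[ℂ] V) = S₂ := by
  obtain ⟨k, hk⟩ := LeibnizAlg.isSolvable_solvableRadical (β := 𝒱.bracket)
    (A := 𝒱.kernelAnnihilator)
  obtain ⟨g, hg, hle⟩ := h₁.exists_map_le_sup hsimple h₂ k
  rw [hk, bot_sup_eq] at hle
  exact ⟨g, hg, LeibnizAlg.IsLeviSubalgebra.eq_of_le_sup (h₁.map hg) h₂
    leibnizKernel_le_kernelAnnihilator (fun a ha x hx => ha.2 x hx)
    (fun a _ x hx => bracket_eq_zero_of_mem_leibnizKernel hx a) hle⟩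

end Conjugacy

end VertexOperatorAlgebra

theorem theorem2p2 {V : Type*} [AddCommGroup V] [Module ℂ V] (𝒱 : VertexOperatorAlgebra V)
    (hsimple : 𝒱.IsSimple) :
    -- (a) `Aut(V)` acts on the set of Levi subalgebras of `F`, and the action is transitive
    ((∀ g ∈ 𝒱.aut, ∀ S : Submodule ℂ V, 𝒱.IsLevi S → 𝒱.IsLevi (S.map (g : V →ₗ[ℂ] V))) ∧
      (∀ S₁ S₂ : Submodule ℂ V, 𝒱.IsLevi S₁ → 𝒱.IsLevi S₂ →
        ∃ g ∈ 𝒱.aut, S₁.map (g : V →ₗ[ℂ] V) = S₂)) ∧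
    -- (b) the modes of the fields of a Levi subalgebra close on an affine algebra
    (∀ S : Submodule ℂ V, 𝒱.IsLevi S →
      ∃ α : LinearMap.BilinForm ℂ S, ∀ u v : S,
        𝒱.mode u 1 v = α u v • 𝒱.vacuum ∧
        ∀ m n : ℤ, ⁅𝒱.mode u m, 𝒱.mode v n⁆ =
          𝒱.mode (𝒱.mode u 0 v) (m + n) +
            (if m + n = 0 then (m : ℂ) * α u v else 0) • LinearMap.id) :=
  ⟨⟨fun _ hg _ hS => hS.map hg, fun _ _ h₁ h₂ => h₁.exists_map_eq hsimple h₂⟩, fun _ hS =>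
    VertexOperatorAlgebra.exists_affine_form hsimple (LeibnizAlg.IsLeviSubalgebra.le hS)
      (LeibnizAlg.IsLeviSubalgebra.map₂_self hS) hS.alternating⟩
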